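/- Let $n\ge 1$ and let $X_1,\dots,X_n$ be independent real random variables on a probability space $(\Omega,\mathcal A,\mathbb P)$ with common continuous distribution function $F_0$. Let $F_n(t)=\frac1n\sum_{i=1}^n 1_{\{X_i\le t\}}$, let $M_n=\sup_{t\in\mathbb R}\{F_n(t)-F_0(t)\}$, let $X_{1:n}\le\dots\le X_{n:n}$ be the order statistics, and let $$R=\min\Big\{1\le k\le n:\ \tfrac in-F_0(X_{i:n})\le \tfrac kn-F_0(X_{k:n})\ \text{ for all } 1\le i\le n\Big\},\qquad W_n^*=\frac{M_n}{\sqrt{F_0(X_{R:n})\,(1-F_0(X_{R:n}))}},$$ where $W_n^*$ is given the value $0$ on the null event that the denominator vanishes. For $c\in(0,1]$ and $x>0$ put $$s(c,x)=\frac{2c+x^2-x\sqrt{4c(1-c)+x^2}}{2(1+x^2)},$$ and for $z\in[0,1)$ and $k\in\{1,\dots,n\}$ put, with $a\wedge b=\min\{a,b\}$ and $[\cdot]$ the floor function, $$q_n[z,k]=\binom{n-1}{k-1}\Big(z\wedge\frac kn\Big)^k\Big(1-\big(z\wedge\frac kn\big)\Big)^{n-k} - n^{-n}\sum_{i=0}^{(k\wedge[nz])-1}\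 \sum_{j=k}^n\binom nj\binom ji\big(n-(nz\wedge k)\big)^{n-j-1}\big((nz\wedge k)-i-1\big)^{j-i}\big(j-(nz\wedge k)\big)(i+1)^{i-1},$$ an empty sum being $0$. Then: 1. $\mathbb P(W_n^*\le x)=1-\sum_{k=1}^n q_n[s(k/n,x),k]$ for all $x>0$. 2. $\mathbb P(W_n^*\le x)=0$ for all $x\le 0$. 3. For all $c\in(0,1]$ and $x>0$, $s=s(c,x)$ lies in $(0,c)$ and satisfies the quadratic equation $(c-s)^2=x^2s(1-s)$. 4. $\mathbb P\big(F_0(X_{R:n})\le z,\ R=k\big)=q_n[z,k]$ for all $z\in[0,1)$ and $k\in\{1,\dots,n\}$. -/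

import Mathlib

open MeasureTheory ProbabilityTheory

noncomputable section

/-- The empirical distribution function `F_n(t) = n⁻¹ ∑ 1{x_i ≤ t}` of a sample `x`. -/
def empCDF {n : ℕ} (x : Fin n → ℝ) (t : ℝ) : ℝ :=
  (1 / (n : ℝ)) * ∑ i : Fin n, if x i ≤ t then (1 : ℝ) else 0

/-- The one-sided Smirnov statistic `M_n = sup_t (F_n(t) - F₀(t))`. -/
def smirnovStat {n : ℕ} (F₀ : ℝ → ℝ) (x : Fin n → ℝ) : ℝ :=
  ⨆ t : ℝ, (empCDF x t - F₀ t)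

/-- The order statistics: `orderStat x 0 ≤ orderStat x 1 ≤ …` is the sample `x` in increasing
order. As `Fin n` starts at `0`, `orderStat x i` is the `(i+1)`-th order statistic. -/
def orderStat {n : ℕ} (x : Fin n → ℝ) (i : Fin n) : ℝ :=
  x (Tuple.sort x i)

/-- The (zero-based) indices `k` that maximize `(k+1)/n - F₀(x_{k+1:n})`. -/
def maxIndices {n : ℕ} (F₀ : ℝ → ℝ) (x : Fin n → ℝ) : Finset (Fin n) :=
  Finset.univ.filter fun k => ∀ i : Fin n,
    (((i : ℕ) + 1 : ℕ) : ℝ) / n - F₀ (orderStat x i)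
      ≤ (((k : ℕ) + 1 : ℕ) : ℝ) / n - F₀ (orderStat x k)

theorem maxIndices_nonempty {n : ℕ} [NeZero n] (F₀ : ℝ → ℝ) (x : Fin n → ℝ) :
    (maxIndices F₀ x).Nonempty := by
  obtain ⟨k, -, hk⟩ := Finset.exists_max_image (Finset.univ : Finset (Fin n))
    (fun i : Fin n => (((i : ℕ) + 1 : ℕ) : ℝ) / n - F₀ (orderStat x i)) Finset.univ_nonempty
  exact ⟨k, Finset.mem_filter.2 ⟨Finset.mem_univ k, fun i => hk i (Finset.mem_univ i)⟩⟩

/-- The smallest maximizing index, zero-based. -/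
def argmaxIndex {n : ℕ} [NeZero n] (F₀ : ℝ → ℝ) (x : Fin n → ℝ) : Fin n :=
  (maxIndices F₀ x).min' (maxIndices_nonempty F₀ x)

/-- The smallest maximizing index `R ∈ {1, …, n}`. -/
def argmaxRank {n : ℕ} [NeZero n] (F₀ : ℝ → ℝ) (x : Fin n → ℝ) : ℕ :=
  (argmaxIndex F₀ x : ℕ) + 1

/-- `F₀(X_{R:n})`. -/
def U_R {n : ℕ} [NeZero n] (F₀ : ℝ → ℝ) (x : Fin n → ℝ) : ℝ :=
  F₀ (orderStat x (argmaxIndex F₀ x))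

/-- The statistic `W_n^* = M_n / √(F₀(X_{R:n}) (1 - F₀(X_{R:n})))`. -/
def WStar {n : ℕ} [NeZero n] (F₀ : ℝ → ℝ) (x : Fin n → ℝ) : ℝ :=
  smirnovStat F₀ x / √(U_R F₀ x * (1 - U_R F₀ x))

/-- `s(c,x) = (2c + x² - x √(4c(1-c) + x²)) / (2(1 + x²))`. -/
def sRoot (c x : ℝ) : ℝ :=
  (2 * c + x ^ 2 - x * √(4 * c * (1 - c) + x ^ 2)) / (2 * (1 + x ^ 2))

/-- The double-sum formula `q_n[z,k]`; the index `i` runs over `0 ≤ i ≤ (k ∧ ⌊nz⌋) - 1`, and the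
exponents `n - j - 1` and `i - 1`, which can be `-1`, are integers. -/
def qFormula (n : ℕ) (z : ℝ) (k : ℕ) : ℝ :=
  ((n - 1).choose (k - 1) : ℝ) * (min z ((k : ℝ) / n)) ^ k * (1 - min z ((k : ℝ) / n)) ^ (n - k)
  - ((n : ℝ) ^ n)⁻¹ *
    ∑ i ∈ Finset.range (min k ⌊(n : ℝ) * z⌋₊), ∑ j ∈ Finset.Icc k n,
      (n.choose j : ℝ) * (j.choose i : ℝ)
        * ((n : ℝ) - min ((n : ℝ) * z) k) ^ ((n : ℤ) - (j : ℤ) - 1)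
        * (min ((n : ℝ) * z) k - (i : ℝ) - 1) ^ (j - i)
        * ((j : ℝ) - min ((n : ℝ) * z) k)
        * ((i : ℝ) + 1) ^ ((i : ℤ) - 1)

end

/-! # The exact law of the standardized one-sided Smirnov statistic

The transformed observations `U_i = F₀(X_i)` are independent and uniform on `(0, 1)`
(`map_cdf_comp_eq_uniform`), and `M_n = R/n - F₀(X_{R:n})` holds for every sample
(`smirnovStat_eq`). As `u ↦ (c - u) / √(u (1 - u))` exceeds `x` exactly below the root `s(c, x)`
(`mul_sqrt_lt_sub_iff`), the law of `W_n^*` follows from the joint law of `F₀(X_{R:n})` and `R`.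

For the joint law, almost surely exactly one of the `n!` orderings of the sample is strictly
increasing, so the probability is `n!` times the volume of the set of ordered configurations in
`(0, 1)^n` whose first maximizer of `i/n - x_i` is `k`. Given `x_k = u`, the coordinates below
and above `u` are constrained separately: those below by `x_{k-m} > u - m/n`, those above by
`x_{k+m} ≥ u + m/n`. Integrating out the extreme coordinate repeatedly yields the two volumes
(`volume_belowRegion`, `volume_aboveRegion`). The upper one is a product of linear factors; the
lower one is a sum over the first violated constraint, and its recursion closes because of Abel's
binomial identity (`sum_choose_mul_abel`).

Finally the product of the two volumes is integrated over `u ≤ min z (k/n)`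
(`factorial_mul_integral_eq_qFormula`). The inner sum of `qFormula` is, for each `i`, the integral
of the term for a violation at the `(i+1)`-st constraint: in its derivative all summands but one
cancel (`hasDerivAt_telescopeSum`).
-/

noncomputable section

/-! ### Abel's binomial identity -/

/-- Abel's binomial identity, in the form
`∑ᵢ C(N,i) (i+1)^(i-1) (y-i-1)^(N-i) = y^N`. By induction the two sides have the same derivative in
`y`, and at `y = 0` and `N ≥ 1` the sum is an `N`-th finite difference of a polynomial of degree `N - 1`. -/
theorem sum_choose_mul_abel (N : ℕ) (y : ℝ) :
    ∑ i ∈ Finset.range (N + 1), (N.choose i : ℝ) * ((i : ℝ) + 1) ^ ((i : ℤ) - 1)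
      * (y - (i + 1)) ^ (N - i) = y ^ N := by
  induction N generalizing y with
  | zero => simp
  | succ N ih =>
    have key : ∀ x y : ℝ,
        (fun y : ℝ => ∑ i ∈ Finset.range (N + 1 + 1),
          ((N + 1).choose i : ℝ) * ((i : ℝ) + 1) ^ ((i : ℤ) - 1)
            * (y - (i + 1)) ^ (N + 1 - i) - y ^ (N + 1)) x =
        (fun y : ℝ => ∑ i ∈ Finset.range (N + 1 + 1),
          ((N + 1).choose i : ℝ) * ((i : ℝ) + 1) ^ ((i : ℤ) - 1)
            * (y - (i + 1)) ^ (N + 1 - i) - y ^ (N + 1)) y := by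
      have hd : ∀ y : ℝ, HasDerivAt (fun y : ℝ => ∑ i ∈ Finset.range (N + 1 + 1),
          ((N + 1).choose i : ℝ) * ((i : ℝ) + 1) ^ ((i : ℤ) - 1)
            * (y - (i + 1)) ^ (N + 1 - i) - y ^ (N + 1)) 0 y := by
        intro y
        have h1 : ∀ i ∈ Finset.range (N + 1 + 1), HasDerivAt (fun y : ℝ =>
            ((N + 1).choose i : ℝ) * ((i : ℝ) + 1) ^ ((i : ℤ) - 1)
            * (y - (i + 1)) ^ (N + 1 - i))
            (((N + 1).choose i : ℝ) * ((i : ℝ) + 1) ^ ((i : ℤ) - 1)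
            * (((N + 1 - i : ℕ) : ℝ) * (y - (i + 1)) ^ (N + 1 - i - 1) * 1)) y := by
          intro i _
          exact (((hasDerivAt_id y).sub_const _).pow _).const_mul _
        refine ((HasDerivAt.fun_sum h1).fun_sub (hasDerivAt_pow (N + 1) y)).congr_deriv ?_
        rw [Finset.sum_range_succ]
        have h2 : ∀ i ∈ Finset.range (N + 1), ((N + 1).choose i : ℝ) * ((i : ℝ) + 1) ^ ((i : ℤ) - 1)
            * (((N + 1 - i : ℕ) : ℝ) * (y - (i + 1)) ^ (N + 1 - i - 1) * 1)
            = ((N : ℝ) + 1) * ((N.choose i : ℝ) * ((i : ℝ) + 1) ^ ((i : ℤ) - 1)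
              * (y - (i + 1)) ^ (N - i)) := by
          intro i hi
          have hc : ((N + 1).choose i : ℝ) * ((N + 1 - i : ℕ) : ℝ) = (N.choose i : ℝ) * (N + 1) := by
            exact_mod_cast (Nat.choose_mul_succ_eq N i).symm
          have he : N + 1 - i - 1 = N - i := by omega
          rw [he]
          linear_combination ((i : ℝ) + 1) ^ ((i : ℤ) - 1) * (y - (i + 1)) ^ (N - i) * hc
        rw [Finset.sum_congr rfl h2, ← Finset.mul_sum, ih]
        simp
      exact is_const_of_deriv_eq_zero (fun y => (hd y).differentiableAt) (fun y => (hd y).deriv)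
    have h0 := key y 0
    have hz : ∑ i ∈ Finset.range (N + 1 + 1),
          ((N + 1).choose i : ℝ) * ((i : ℝ) + 1) ^ ((i : ℤ) - 1)
            * ((0 : ℝ) - (i + 1)) ^ (N + 1 - i) = 0 := by
      have h3 := congrFun (fwdDiff_iter_pow_eq_zero_of_lt (R := ℝ) (Nat.lt_succ_self N)) 1
      rw [fwdDiff_iter_eq_sum_shift] at h3
      rw [Pi.zero_apply] at h3
      refine Eq.trans (Finset.sum_congr rfl fun i hi => ?_) h3
      have hi' : i ≤ N + 1 := by simpa [Nat.lt_succ_iff] using hi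
      have hpos : ((i : ℝ) + 1) ≠ 0 := by positivity
      have h4 : ((i : ℝ) + 1) ^ ((i : ℤ) - 1) * ((i : ℝ) + 1) ^ (N + 1 - i) = ((i : ℝ) + 1) ^ N := by
        rw [← zpow_natCast, ← zpow_add₀ hpos, ← zpow_natCast]
        congr 1
        push_cast [Nat.cast_sub hi']
        ring
      rw [zero_sub, neg_pow, zsmul_eq_mul, nsmul_one]
      push_cast
      rw [add_comm (1 : ℝ) (i : ℝ), ← h4]
      simp only [Nat.succ_eq_add_one]
      ring
    simp only at h0
    rw [hz] at h0
    simp at h0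
    linarith

/-! ### The volume polynomials of the two sides of the maximizing observation -/

/-- `N!` times the volume of the configurations `0 < v₁ < ⋯ < v_N < d` with `v_m < m h` for all `m`
(see `volume_belowRegion`). The `i`-th summand accounts for the configurations whose first
violation of the constraints is that of `v_{i+1}`. -/
def belowPoly (h : ℝ) (N : ℕ) (d : ℝ) : ℝ :=
  d ^ N - ∑ i ∈ Finset.range N, (N.choose i : ℝ) * ((i : ℝ) + 1) ^ ((i : ℤ) - 1) * h ^ i
    * (max (d - (i + 1) * h) 0) ^ (N - i)

/-- `N!` times the volume of the configurations `0 < v₁ < ⋯ < v_N < L` with `m h ≤ v_m` for all `m`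
(see `volume_aboveRegion`), which is `L^(N-1) (L - N h)`; this form also covers `N = 0`. -/
def abovePoly (h : ℝ) (N : ℕ) (L : ℝ) : ℝ :=
  L ^ N - N * h * L ^ (N - 1)

@[fun_prop]
theorem continuous_belowPoly (h : ℝ) (N : ℕ) : Continuous (belowPoly h N) := by
  unfold belowPoly
  fun_prop

@[fun_prop]
theorem continuous_abovePoly (h : ℝ) (N : ℕ) : Continuous (abovePoly h N) := by
  unfold abovePoly
  fun_prop

theorem abovePoly_nonneg {h L : ℝ} {N : ℕ} (hL : 0 ≤ L) (hNL : N * h ≤ L) :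
    0 ≤ abovePoly h N L := by
  rcases N with _ | N
  · simp [abovePoly]
  · have : abovePoly h (N + 1) L = L ^ N * (L - (N + 1 : ℕ) * h) := by
      simp only [abovePoly, Nat.add_sub_cancel]
      ring
    rw [this]
    exact mul_nonneg (by positivity) (by linarith)

theorem integral_abovePoly (h : ℝ) (N : ℕ) (b : ℝ) :
    ∫ v in ((N + 1 : ℕ) * h)..b, abovePoly h N v = abovePoly h (N + 1) b / (N + 1) := by
  have hd : ∀ v : ℝ, HasDerivAt (fun v => abovePoly h (N + 1) v / (N + 1)) (abovePoly h N v) v := by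
    intro v
    have := ((hasDerivAt_pow (N + 1) v).fun_sub
      ((hasDerivAt_pow N v).const_mul (((N + 1 : ℕ) : ℝ) * h))).div_const ((N : ℝ) + 1)
    simp only [abovePoly, Nat.add_sub_cancel]
    refine this.congr_deriv ?_
    have : (N : ℝ) + 1 ≠ 0 := by positivity
    rw [Nat.cast_add_one, div_eq_iff this, Nat.add_sub_cancel]
    ring
  rw [intervalIntegral.integral_eq_sub_of_hasDerivAt (fun v _ => hd v)
    ((continuous_abovePoly h N).intervalIntegrable _ _)]
  have : abovePoly h (N + 1) ((N + 1 : ℕ) * h) = 0 := by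
    simp only [abovePoly, Nat.add_sub_cancel]
    ring
  rw [this]
  simp

/-- A truncated power in the integrand restricts the integral to where it is positive. -/
theorem integral_max_pow_mul {c w : ℝ} (hc : 0 ≤ c) (hw : 0 ≤ w) {r : ℕ} (hr : r ≠ 0) {g : ℝ → ℝ}
    (hg : Continuous g) :
    ∫ u in (0 : ℝ)..w, (max (u - c) 0) ^ r * g u =
      if c ≤ w then ∫ u in c..w, (u - c) ^ r * g u else 0 := by
  have hz : ∀ b : ℝ, 0 ≤ b → b ≤ c → ∫ u in (0 : ℝ)..b, (max (u - c) 0) ^ r * g u = 0 := by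
    intro b hb hbc
    have : ∫ u in (0 : ℝ)..b, (max (u - c) 0) ^ r * g u = ∫ u in (0 : ℝ)..b, (0 : ℝ) := by
      refine intervalIntegral.integral_congr fun u hu => ?_
      rw [Set.uIcc_of_le hb] at hu
      have : max (u - c) 0 = 0 := max_eq_right (by linarith [hu.2])
      simp [this, hr]
    rw [this]
    simp
  split_ifs with h
  · have hcont : Continuous fun u => (max (u - c) 0) ^ r * g u := by fun_prop
    rw [← intervalIntegral.integral_add_adjacent_intervals (b := c)
      (hcont.intervalIntegrable _ _) (hcont.intervalIntegrable _ _), hz c hc le_rfl, zero_add]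
    refine intervalIntegral.integral_congr fun u hu => ?_
    rw [Set.uIcc_of_le h] at hu
    have : max (u - c) 0 = u - c := max_eq_left (by linarith [hu.1])
    simp only [this]
  · exact hz w hw (le_of_not_ge h)

theorem integral_max_pow {c w : ℝ} (hc : 0 ≤ c) (hw : 0 ≤ w) {r : ℕ} (hr : r ≠ 0) :
    ∫ u in (0 : ℝ)..w, (max (u - c) 0) ^ r = (max (w - c) 0) ^ (r + 1) / (r + 1) := by
  have := integral_max_pow_mul hc hw hr (g := fun _ => 1) continuous_const
  simp only [mul_one] at this
  rw [this]
  split_ifs with h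
  · rw [max_eq_left (by linarith), intervalIntegral.integral_comp_sub_right (fun u => u ^ r) c,
      integral_pow]
    simp
  · rw [max_eq_right (by linarith [not_le.1 h])]
    simp

theorem integral_belowPoly {h : ℝ} (hh : 0 ≤ h) (N : ℕ) {d : ℝ} (hd : 0 ≤ d)
    (hdN : d ≤ (N + 1) * h) :
    ∫ v in (0 : ℝ)..d, belowPoly h N v = belowPoly h (N + 1) d / (N + 1) := by
  have hN : (N : ℝ) + 1 ≠ 0 := by positivity
  unfold belowPoly
  rw [intervalIntegral.integral_sub (Continuous.intervalIntegrable (by fun_prop) _ _)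
    (Continuous.intervalIntegrable (by fun_prop) _ _),
    intervalIntegral.integral_finsetSum
      (fun i _ => Continuous.intervalIntegrable (by fun_prop) _ _), integral_pow,
    Finset.sum_range_succ, max_eq_right (show d - ((N : ℝ) + 1) * h ≤ 0 by linarith), sub_div, sub_div,
    show (0 : ℝ) ^ (N + 1 - N) = 0 by simp, mul_zero, add_zero, Finset.sum_div]
  rw [zero_pow (Nat.succ_ne_zero N), zero_div, sub_zero]
  congr 1
  refine Finset.sum_congr rfl fun i hi => ?_
  have hi' : i < N := Finset.mem_range.1 hi
  have hc : ((N + 1).choose i : ℝ) * ((N - i : ℕ) + 1) = (N.choose i : ℝ) * (N + 1) := by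
    have := Nat.choose_mul_succ_eq N i
    rw [Nat.succ_sub hi'.le] at this
    exact_mod_cast this.symm
  have hr : ((N - i : ℕ) : ℝ) + 1 ≠ 0 := by positivity
  rw [intervalIntegral.integral_const_mul, integral_max_pow (by positivity) hd (by omega),
    show N + 1 - i = N - i + 1 by omega, ← mul_div_assoc, div_eq_div_iff hr hN]
  linear_combination (-1 : ℝ) * ((i : ℝ) + 1) ^ ((i : ℤ) - 1) * h ^ i
    * max (d - (i + 1) * h) 0 ^ (N - i + 1) * hc

/-- Above its last kink the polynomial is constant, by Abel's identity. -/
theorem belowPoly_eq_const {h : ℝ} (hh : 0 < h) (N : ℕ) {d : ℝ} (hd : N * h ≤ d) :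
    belowPoly h N d = ((N : ℝ) + 1) ^ ((N : ℤ) - 1) * h ^ N := by
  have hab := sum_choose_mul_abel N (d / h)
  have hdh : d = d / h * h := by field_simp
  rw [Finset.sum_range_succ] at hab
  simp only [Nat.choose_self, Nat.sub_self, pow_zero, Nat.cast_one, one_mul, mul_one] at hab
  unfold belowPoly
  have h1 : ∑ i ∈ Finset.range N, (N.choose i : ℝ) * ((i : ℝ) + 1) ^ ((i : ℤ) - 1) * h ^ i
      * (max (d - (i + 1) * h) 0) ^ (N - i) = h ^ N * ∑ i ∈ Finset.range N,
      (N.choose i : ℝ) * ((i : ℝ) + 1) ^ ((i : ℤ) - 1) * (d / h - (i + 1)) ^ (N - i) := by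
    rw [Finset.mul_sum]
    refine Finset.sum_congr rfl fun i hi => ?_
    have hi' : i < N := Finset.mem_range.1 hi
    have hiN : (i : ℝ) + 1 ≤ N := by exact_mod_cast hi'
    have h2 : d - (i + 1) * h = (d / h - (i + 1)) * h := by
      rw [sub_mul]
      field_simp
    rw [max_eq_left (by nlinarith), h2, mul_pow]
    have h3 : h ^ N = h ^ i * h ^ (N - i) := by
      rw [← pow_add]
      congr 1
      omega
    rw [h3]
    ring
  rw [h1, hdh, mul_pow, ← hab]
  have : d / h * h / h = d / h := by field_simp
  rw [this]
  ring

theorem belowPoly_min {h : ℝ} (hh : 0 < h) (N : ℕ) (d : ℝ) :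
    belowPoly h N (min d (N * h)) = belowPoly h N d := by
  rcases le_total d (N * h) with hd | hd
  · rw [min_eq_left hd]
  · rw [min_eq_right hd, belowPoly_eq_const hh N hd, belowPoly_eq_const hh N le_rfl]

theorem belowPoly_nonneg {h : ℝ} (hh : 0 < h) (N : ℕ) {d : ℝ} (hd : 0 ≤ d) :
    0 ≤ belowPoly h N d := by
  induction N generalizing d with
  | zero => simp [belowPoly]
  | succ N ih =>
    have h1 := integral_belowPoly hh.le N (d := min d ((N + 1 : ℕ) * h)) (by positivity)
      (by push_cast; exact min_le_right _ _)
    rw [belowPoly_min hh, eq_div_iff (by positivity)] at h1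
    rw [← h1]
    exact mul_nonneg (intervalIntegral.integral_nonneg (by positivity) fun u hu => ih hu.1)
      (by positivity)

/-! ### Integrating the joint density of the maximizing value and its rank -/

/-- The `j`-sum of `qFormula`, as a function of `y = n z`, in which `t = j - k`, `r = k - 1 - i`,
`q = n - k` and `c = i + 1`. The negative power of `n - y` at `j = n` is avoided by
`(n-y)^(n-j-1) (j-y) = (n-y)^(n-j) - (n-j) (n-y)^(n-j-1)`. -/
def telescopeSum (n c : ℝ) (q r : ℕ) (y : ℝ) : ℝ :=
  ∑ t ∈ Finset.range (q + 1), ((n - y) ^ (q - t) - (q - t : ℕ) * (n - y) ^ (q - t - 1))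
    * (y - c) ^ (r + 1 + t) / ((q - t).factorial * (r + 1 + t).factorial)

/-- The derivatives of the summands telescope: only the contribution of `j = k` survives. -/
theorem hasDerivAt_telescopeSum (n c : ℝ) (q r : ℕ) (y : ℝ) :
    HasDerivAt (telescopeSum n c q r)
      (((n - y) ^ q - q * (n - y) ^ (q - 1)) * (y - c) ^ r / (q.factorial * r.factorial)) y := by
  have hA : HasDerivAt (fun y => n - y) (-1) y := by
    simpa using (hasDerivAt_id y).const_sub n
  have hB : HasDerivAt (fun y => y - c) 1 y := (hasDerivAt_id y).sub_const c
  induction q generalizing r with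
  | zero =>
    have h := (hB.fun_pow (r + 1)).div_const ((r + 1).factorial : ℝ)
    have hf : telescopeSum n c 0 r = fun y => (y - c) ^ (r + 1) / ((r + 1).factorial : ℝ) := by
      funext y
      simp [telescopeSum]
    rw [hf]
    refine h.congr_deriv ?_
    have h1 : ((r : ℝ) + 1) ≠ 0 := by positivity
    have h2 : (r.factorial : ℝ) ≠ 0 := by positivity
    simp [Nat.factorial_succ]
    field_simp
  | succ q ih =>
    have hf : telescopeSum n c (q + 1) r = fun y =>
        ((n - y) ^ (q + 1) - (q + 1 : ℕ) * (n - y) ^ q) * (y - c) ^ (r + 1)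
          / ((q + 1).factorial * (r + 1).factorial) + telescopeSum n c q (r + 1) y := by
      funext y
      unfold telescopeSum
      rw [Finset.sum_range_succ', add_comm]
      congr 1
      refine Finset.sum_congr rfl fun t _ => ?_
      rw [Nat.add_sub_add_right, show r + 1 + (t + 1) = r + 1 + 1 + t by ring]
    rw [hf]
    have h := ((((hA.fun_pow (q + 1)).fun_sub ((hA.fun_pow q).const_mul ((q + 1 : ℕ) : ℝ))).fun_mul
      (hB.fun_pow (r + 1))).div_const
        ((q + 1).factorial * (r + 1).factorial : ℝ)).fun_add (ih (r + 1))
    refine h.congr_deriv ?_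
    have h1 : ((r : ℝ) + 1) ≠ 0 := by positivity
    have h2 : (r.factorial : ℝ) ≠ 0 := by positivity
    have h3 : ((q : ℝ) + 1) ≠ 0 := by positivity
    have h4 : (q.factorial : ℝ) ≠ 0 := by positivity
    simp only [Nat.factorial_succ, Nat.add_sub_cancel]
    push_cast
    field_simp
    ring

theorem telescopeSum_self (n c : ℝ) (q r : ℕ) : telescopeSum n c q r c = 0 := by
  unfold telescopeSum
  refine Finset.sum_eq_zero fun t _ => ?_
  rw [sub_self, zero_pow (by omega)]
  simp

/-- The contribution to the joint density of the configurations without constraints below the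
maximizing value. -/
theorem integral_pow_mul_abovePoly {n p q : ℕ} (hn : n = p + 1 + q) (w : ℝ) :
    ∫ u in (0 : ℝ)..w, u ^ p * abovePoly ((n : ℝ)⁻¹) q (1 - u) =
      w ^ (p + 1) * (1 - w) ^ q / n := by
  have hn0 : (n : ℝ) ≠ 0 := by
    rw [hn]
    positivity
  have hn' : (n : ℝ) = p + 1 + q := by
    rw [hn]
    push_cast
    ring
  have hd : ∀ u : ℝ, HasDerivAt (fun u => u ^ (p + 1) * (1 - u) ^ q / (n : ℝ))
      (u ^ p * abovePoly ((n : ℝ)⁻¹) q (1 - u)) u := by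
    intro u
    have hA : HasDerivAt (fun u : ℝ => 1 - u) (-1) u := by
      simpa using (hasDerivAt_id u).const_sub 1
    refine (((hasDerivAt_pow (p + 1) u).fun_mul (hA.fun_pow q)).div_const (n : ℝ)).congr_deriv ?_
    unfold abovePoly
    rw [div_eq_iff hn0]
    have h1 : u ^ p * ((1 - u) ^ q - q * (n : ℝ)⁻¹ * (1 - u) ^ (q - 1)) * n
        = u ^ p * (n * (1 - u) ^ q - q * (1 - u) ^ (q - 1)) := by
      field_simp
    rw [h1, hn', Nat.add_sub_cancel]
    rcases q with _ | q
    · simp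
      ring
    · push_cast
      ring
  rw [intervalIntegral.integral_eq_sub_of_hasDerivAt (fun v _ => hd v)
    (Continuous.intervalIntegrable (by fun_prop) _ _)]
  simp

/-- The contribution to the joint density of a first violation at the `(i+1)`-st constraint below
the maximizing value, where `c = i + 1` and `r = k - 1 - i`. -/
theorem integral_sub_pow_mul_abovePoly {n : ℕ} (hn : n ≠ 0) (q r : ℕ) (c w : ℝ) :
    ∫ u in (c * (n : ℝ)⁻¹)..w, (u - c * (n : ℝ)⁻¹) ^ r * abovePoly ((n : ℝ)⁻¹) q (1 - u) =
      q.factorial * r.factorial * telescopeSum n c q r (n * w) / n ^ (q + r + 1) := by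
  have hn0 : (n : ℝ) ≠ 0 := by exact_mod_cast hn
  have hd : ∀ u : ℝ, HasDerivAt
      (fun u => q.factorial * r.factorial * telescopeSum n c q r (n * u) / (n : ℝ) ^ (q + r + 1))
      ((u - c * (n : ℝ)⁻¹) ^ r * abovePoly ((n : ℝ)⁻¹) q (1 - u)) u := by
    intro u
    have h := (hasDerivAt_telescopeSum n c q r (n * u)).comp u
      ((hasDerivAt_id u).const_mul (n : ℝ))
    refine ((h.const_mul (q.factorial * r.factorial : ℝ)).div_const
      ((n : ℝ) ^ (q + r + 1))).congr_deriv ?_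
    have h2 : (r.factorial : ℝ) ≠ 0 := by positivity
    have h4 : (q.factorial : ℝ) ≠ 0 := by positivity
    have e1 : (n : ℝ) - n * u = n * (1 - u) := by ring
    have e2 : (n : ℝ) * u - c = n * (u - c * (n : ℝ)⁻¹) := by field_simp
    rw [e1, e2, mul_pow, mul_pow, mul_pow]
    unfold abovePoly
    rcases q with _ | q
    · field_simp
      simp
      ring
    · rw [Nat.add_sub_cancel]
      field_simp
      ring
  rw [intervalIntegral.integral_eq_sub_of_hasDerivAt (fun v _ => hd v)
    (Continuous.intervalIntegrable (by fun_prop) _ _)]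
  have : (n : ℝ) * (c * (n : ℝ)⁻¹) = c := by field_simp
  simp [this, telescopeSum_self]

theorem choose_mul_choose_eq_factorial_div {n i j : ℕ} (hij : i ≤ j) (hjn : j ≤ n) :
    (n.choose j : ℝ) * (j.choose i : ℝ)
      = n.factorial / (i.factorial * (n - j).factorial * (j - i).factorial) := by
  rw [Nat.cast_choose ℝ hjn, Nat.cast_choose ℝ hij]
  have : (j.factorial : ℝ) ≠ 0 := by positivity
  field_simp

/-- The `j`-sum of `qFormula` in terms of `telescopeSum`. -/
theorem sum_Icc_eq_telescopeSum {n p q i : ℕ} (hn : n = p + 1 + q) (hi : i ≤ p) {y : ℝ}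
    (hy : y < n) :
    ∑ j ∈ Finset.Icc (p + 1) n, (n.choose j : ℝ) * (j.choose i : ℝ)
        * ((n : ℝ) - y) ^ ((n : ℤ) - (j : ℤ) - 1) * (y - (i : ℝ) - 1) ^ (j - i) * ((j : ℝ) - y)
        * ((i : ℝ) + 1) ^ ((i : ℤ) - 1)
      = n.factorial / i.factorial * ((i : ℝ) + 1) ^ ((i : ℤ) - 1)
        * telescopeSum n (i + 1) q (p - i) y := by
  unfold telescopeSum
  rw [Finset.mul_sum, show Finset.Icc (p + 1) n = Finset.Ico (p + 1) (n + 1) by rfl,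
    Finset.sum_Ico_eq_sum_range, show n + 1 - (p + 1) = q + 1 by omega]
  refine Finset.sum_congr rfl fun t ht => ?_
  have ht' : t ≤ q := by simpa [Nat.lt_succ_iff] using ht
  obtain ⟨s, rfl⟩ := Nat.exists_eq_add_of_le ht'
  have hA : (n : ℝ) - y ≠ 0 := by linarith
  rw [choose_mul_choose_eq_factorial_div (by omega) (by omega),
    show n - (p + 1 + t) = s by omega, show p + 1 + t - i = p - i + 1 + t by omega,
    show t + s - t = s by omega,
    show (n : ℤ) - ((p + 1 + t : ℕ) : ℤ) - 1 = (s : ℤ) - 1 by push_cast [hn]; ring]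
  have hj : ((p + 1 + t : ℕ) : ℝ) - y = (n - y) - s := by
    push_cast [hn]
    ring
  have hz : ((n : ℝ) - y) ^ ((s : ℤ) - 1) * ((n - y) - s)
      = (n - y) ^ s - s * (n - y) ^ (s - 1) := by
    rcases s with _ | s
    · simp [hA]
    · rw [show ((s + 1 : ℕ) : ℤ) - 1 = (s : ℤ) by push_cast; ring, zpow_natCast, Nat.add_sub_cancel]
      ring
  have hB : y - ((i : ℝ) + 1) = y - i - 1 := by ring
  rw [hj, ← hz, hB]
  have h1 : (i.factorial : ℝ) ≠ 0 := by positivity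
  have h2 : (s.factorial : ℝ) ≠ 0 := by positivity
  have h3 : ((p - i + 1 + t).factorial : ℝ) ≠ 0 := by positivity
  field_simp

/-- The joint density of the maximizing value and its rank integrates to `qFormula`. -/
theorem factorial_mul_integral_eq_qFormula {n p q : ℕ} (hn : n = p + 1 + q) {z : ℝ} (hz : 0 ≤ z)
    (hz1 : z < 1) :
    (n.factorial : ℝ) * ∫ u in (0 : ℝ)..min z (((p + 1 : ℕ) : ℝ) / n),
        belowPoly ((n : ℝ)⁻¹) p u / p.factorial
          * (abovePoly ((n : ℝ)⁻¹) q (1 - u) / q.factorial)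
      = qFormula n z (p + 1) := by
  have hn0 : (n : ℝ) ≠ 0 := by
    rw [hn]
    positivity
  have hnpos : (0 : ℝ) < n := by positivity
  set w := min z (((p + 1 : ℕ) : ℝ) / n) with hw
  have hw0 : 0 ≤ w := by positivity
  have hnw : min ((n : ℝ) * z) ((p + 1 : ℕ) : ℝ) = n * w := by
    rw [hw, mul_min_of_nonneg _ _ hnpos.le]
    congr 1
    field_simp
  have hyn : (n : ℝ) * w < n := by
    have : w < 1 := (min_le_left _ _).trans_lt hz1
    nlinarith
  set F : ℕ → ℝ := fun i => n.factorial / i.factorial * ((i : ℝ) + 1) ^ ((i : ℤ) - 1)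
        * telescopeSum n (i + 1) q (p - i) (n * w) with hF
  have hle : ∀ i : ℕ, ((i : ℝ) + 1) * (n : ℝ)⁻¹ ≤ w ↔ i + 1 ≤ ⌊(n : ℝ) * z⌋₊ ∧ i ≤ p := by
    intro i
    rw [Nat.le_floor_iff (by positivity), hw, le_min_iff, ← div_eq_mul_inv, div_le_iff₀ hnpos,
      div_le_div_iff_of_pos_right hnpos, mul_comm z, ← Nat.cast_add_one, Nat.cast_le,
      Nat.add_le_add_iff_right]
  have hq : qFormula n z (p + 1) = ((n - 1).choose p : ℝ) * w ^ (p + 1) * (1 - w) ^ q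
      - ((n : ℝ) ^ n)⁻¹ * ∑ i ∈ Finset.range p,
        if ((i : ℝ) + 1) * (n : ℝ)⁻¹ ≤ w then F i else 0 := by
    unfold qFormula
    rw [← hw, hnw, show n - (p + 1) = q by omega, Nat.add_sub_cancel]
    congr 2
    rw [← Finset.sum_filter]
    symm
    refine (Finset.sum_subset ?_ ?_).trans (Finset.sum_congr rfl fun i hi => ?_)
    · intro i hi
      rw [Finset.mem_filter, hle, Finset.mem_range] at hi
      rw [Finset.mem_range]
      omega
    · intro i hi hi'
      rw [Finset.mem_filter, hle, Finset.mem_range] at hi'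
      rw [Finset.mem_range] at hi
      -- Only `i = p` is left, where `n w = p + 1` makes the summand vanish.
      obtain rfl : i = p := by omega
      have h1 : ((i : ℝ) + 1) * (n : ℝ)⁻¹ ≤ w := (hle i).2 (by omega)
      have h2 : w ≤ ((i : ℝ) + 1) * (n : ℝ)⁻¹ := by
        rw [← div_eq_mul_inv, ← Nat.cast_add_one]
        exact min_le_right _ _
      have h3 : (n : ℝ) * w = i + 1 := by
        rw [le_antisymm h2 h1]
        field_simp
      rw [hF]
      simp only
      rw [h3, telescopeSum_self, mul_zero]
    · rw [Finset.mem_range] at hi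
      exact (sum_Icc_eq_telescopeSum hn (by omega) hyn).symm
  have hint : ∫ u in (0 : ℝ)..w, belowPoly ((n : ℝ)⁻¹) p u * abovePoly ((n : ℝ)⁻¹) q (1 - u)
      = w ^ (p + 1) * (1 - w) ^ q / n - ∑ i ∈ Finset.range p, (p.choose i : ℝ)
          * ((i : ℝ) + 1) ^ ((i : ℤ) - 1) * (n : ℝ)⁻¹ ^ i
          * (if ((i : ℝ) + 1) * (n : ℝ)⁻¹ ≤ w then q.factorial * (p - i).factorial
            * telescopeSum n (i + 1) q (p - i) (n * w) / (n : ℝ) ^ (q + (p - i) + 1) else 0) := by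
    rw [← integral_pow_mul_abovePoly hn]
    have : ∀ i ∈ Finset.range p, (p.choose i : ℝ)
          * ((i : ℝ) + 1) ^ ((i : ℤ) - 1) * (n : ℝ)⁻¹ ^ i
          * (if ((i : ℝ) + 1) * (n : ℝ)⁻¹ ≤ w then q.factorial * (p - i).factorial
            * telescopeSum n (i + 1) q (p - i) (n * w) / (n : ℝ) ^ (q + (p - i) + 1) else 0)
        = ∫ u in (0 : ℝ)..w, (p.choose i : ℝ)
          * ((i : ℝ) + 1) ^ ((i : ℤ) - 1) * (n : ℝ)⁻¹ ^ i
          * ((max (u - (i + 1) * (n : ℝ)⁻¹) 0) ^ (p - i)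
            * abovePoly ((n : ℝ)⁻¹) q (1 - u)) := by
      intro i hi
      have hi' : i < p := Finset.mem_range.1 hi
      rw [intervalIntegral.integral_const_mul, integral_max_pow_mul (by positivity) hw0 (by omega)
        (g := fun u => abovePoly ((n : ℝ)⁻¹) q (1 - u)) (by fun_prop),
        integral_sub_pow_mul_abovePoly (by omega)]
    rw [Finset.sum_congr rfl this, ← intervalIntegral.integral_finsetSum
      (fun i _ => Continuous.intervalIntegrable (by fun_prop) _ _), ← intervalIntegral.integral_sub
      (Continuous.intervalIntegrable (by fun_prop) _ _)
      (Continuous.intervalIntegrable (by fun_prop) _ _)]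
    congr 1
    funext u
    rw [belowPoly, sub_mul, Finset.sum_mul]
    congr 1
    exact Finset.sum_congr rfl fun i _ => by ring
  have hp : (p.factorial : ℝ) ≠ 0 := by positivity
  have hqf : (q.factorial : ℝ) ≠ 0 := by positivity
  have hsplit : ∀ u : ℝ, belowPoly ((n : ℝ)⁻¹) p u / p.factorial
          * (abovePoly ((n : ℝ)⁻¹) q (1 - u) / q.factorial)
      = (p.factorial * q.factorial : ℝ)⁻¹
        * (belowPoly ((n : ℝ)⁻¹) p u * abovePoly ((n : ℝ)⁻¹) q (1 - u)) := by
    intro u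
    field_simp
  simp only [hsplit]
  rw [intervalIntegral.integral_const_mul, hint, hq, mul_sub, mul_sub]
  congr 1
  · rw [Nat.cast_choose ℝ (by omega), show n - 1 - p = q by omega,
      ← Nat.mul_factorial_pred (show n ≠ 0 by omega)]
    push_cast
    field_simp
  · rw [Finset.mul_sum, Finset.mul_sum, Finset.mul_sum]
    refine Finset.sum_congr rfl fun i hi => ?_
    have hi' : i < p := Finset.mem_range.1 hi
    split_ifs
    · rw [hF, Nat.cast_choose ℝ hi'.le]
      have hnn : (n : ℝ) ^ n = n ^ (q + (p - i) + 1) * n ^ i := by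
        rw [← pow_add]
        congr 1
        omega
      rw [hnn, inv_pow]
      have h1 : (i.factorial : ℝ) ≠ 0 := by positivity
      have h2 : ((p - i).factorial : ℝ) ≠ 0 := by positivity
      field_simp
    · simp

/-! ### Volumes of regions of ordered configurations -/

theorem measurableSet_strictMono (N : ℕ) : MeasurableSet {y : Fin N → ℝ | StrictMono y} := by
  have : {y : Fin N → ℝ | StrictMono y} = ⋂ i, ⋂ j, ⋂ (_ : i < j), {y | y i < y j} := by
    ext y
    simp [StrictMono]
  rw [this]
  exact MeasurableSet.iInter fun i => MeasurableSet.iInter fun j => MeasurableSet.iInter fun _ =>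
    measurableSet_lt (measurable_pi_apply i) (measurable_pi_apply j)

/-- Fubini's theorem for the volume of a set, with one coordinate singled out. -/
theorem volume_eq_lintegral_insertNth {N : ℕ} (i : Fin (N + 1)) {E : Set (Fin (N + 1) → ℝ)}
    (hE : MeasurableSet E) :
    volume E = ∫⁻ v, volume {y : Fin N → ℝ | i.insertNth (α := fun _ => ℝ) v y ∈ E} := by
  have hmp := (volume_preserving_piFinSuccAbove (fun _ : Fin (N + 1) => ℝ) i).symm
  rw [← hmp.measure_preimage hE.nullMeasurableSet, Measure.volume_eq_prod,
    Measure.prod_apply (hE.preimage hmp.measurable)]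
  rfl

/-- Integrating a volume over an interval on which it is a known polynomial. -/
theorem lintegral_eq_ofReal_of_Ioo {φ : ℝ → ENNReal} {f : ℝ → ℝ} {a b : ℝ} (hab : a ≤ b)
    (hf : Continuous f) (hf0 : ∀ v, a < v → v < b → 0 ≤ f v)
    (hφ : ∀ v, a < v → v < b → φ v = ENNReal.ofReal (f v))
    (hφ0 : ∀ v, ¬ (a ≤ v ∧ v ≤ b) → φ v = 0) :
    ∫⁻ v, φ v = ENNReal.ofReal (∫ v in a..b, f v) := by
  have h1 : ∫⁻ v, φ v = ∫⁻ v in Set.Ioo a b, φ v := by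
    rw [setLIntegral_congr Ioo_ae_eq_Icc, ← lintegral_indicator measurableSet_Icc]
    congr 1
    funext v
    by_cases hv : v ∈ Set.Icc a b
    · rw [Set.indicator_of_mem hv]
    · rw [Set.indicator_of_notMem hv, hφ0 v hv]
  have h2 : ∫⁻ v in Set.Ioo a b, φ v = ∫⁻ v in Set.Ioo a b, ENNReal.ofReal (f v) :=
    setLIntegral_congr_fun measurableSet_Ioo fun v hv => hφ v hv.1 hv.2
  rw [h1, h2, intervalIntegral.integral_of_le hab, integral_Ioc_eq_integral_Ioo,
    ofReal_integral_eq_lintegral_ofReal]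
  · exact (hf.continuousOn.integrableOn_Icc (μ := volume)).mono_set Set.Ioo_subset_Icc_self
  · exact (ae_restrict_iff' measurableSet_Ioo).2 (ae_of_all _ fun v hv => hf0 v hv.1 hv.2)

/-- Ordered configurations in `(c, u)` whose `m`-th largest value exceeds `u - m h`, for all `m`. -/
def belowRegion (h : ℝ) (N : ℕ) (c u : ℝ) : Set (Fin N → ℝ) :=
  {y | StrictMono y ∧ ∀ i, c < y i ∧ y i < u ∧ u - ((N : ℝ) - (i : ℕ)) * h < y i}

/-- Ordered configurations in `(u, b)` whose `m`-th smallest value is at least `u + m h`, for all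
`m`. -/
def aboveRegion (h : ℝ) (N : ℕ) (u b : ℝ) : Set (Fin N → ℝ) :=
  {y | StrictMono y ∧ ∀ i, u < y i ∧ y i < b ∧ u + ((i : ℕ) + 1 : ℝ) * h ≤ y i}

theorem measurableSet_belowRegion (h : ℝ) (N : ℕ) (c u : ℝ) :
    MeasurableSet (belowRegion h N c u) := by
  have : belowRegion h N c u = {y : Fin N → ℝ | StrictMono y} ∩
      ⋂ i : Fin N, {y : Fin N → ℝ | c < y i ∧ y i < u ∧ u - ((N : ℝ) - (i : ℕ)) * h < y i} := by
    ext y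
    simp [belowRegion]
  rw [this]
  refine (measurableSet_strictMono N).inter (MeasurableSet.iInter fun i => ?_)
  measurability

theorem measurableSet_aboveRegion (h : ℝ) (N : ℕ) (u b : ℝ) :
    MeasurableSet (aboveRegion h N u b) := by
  have : aboveRegion h N u b = {y : Fin N → ℝ | StrictMono y} ∩
      ⋂ i : Fin N, {y : Fin N → ℝ | u < y i ∧ y i < b ∧ u + ((i : ℕ) + 1 : ℝ) * h ≤ y i} := by
    ext y
    simp [aboveRegion]
  rw [this]
  refine (measurableSet_strictMono N).inter (MeasurableSet.iInter fun i => ?_)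
  measurability

theorem cons_mem_belowRegion {h : ℝ} {N : ℕ} {c u v : ℝ} {y : Fin N → ℝ} :
    (Fin.cons v y : Fin (N + 1) → ℝ) ∈ belowRegion h (N + 1) c u ↔
      (c < v ∧ v < u ∧ u - ((N : ℝ) + 1) * h < v) ∧ y ∈ belowRegion h N v u := by
  simp only [belowRegion, Set.mem_ofPred_eq, Fin.forall_fin_succ, Fin.cons_zero, Fin.cons_succ,
    StrictMono]
  simp
  grind

theorem snoc_mem_aboveRegion {h : ℝ} {N : ℕ} {u b v : ℝ} {y : Fin N → ℝ} :
    (Fin.snoc y v : Fin (N + 1) → ℝ) ∈ aboveRegion h (N + 1) u b ↔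
      (u < v ∧ v < b ∧ u + ((N : ℝ) + 1) * h ≤ v) ∧ y ∈ aboveRegion h N u v := by
  simp only [aboveRegion, Set.mem_ofPred_eq, Fin.forall_fin_succ', Fin.snoc_last, Fin.snoc_castSucc,
    StrictMono]
  simp
  grind

/-- Integrating out the smallest value. -/
theorem volume_belowRegion {h : ℝ} (hh : 0 < h) (N : ℕ) {c u : ℝ} (hcu : c ≤ u)
    (hu : u - c ≤ (N + 1) * h) :
    volume (belowRegion h N c u) = ENNReal.ofReal (belowPoly h N (u - c) / N.factorial) := by
  induction N generalizing c with
  | zero =>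
    have : belowRegion h 0 c u = Set.univ := by
      ext y
      simp [belowRegion, StrictMono]
    rw [this]
    simp [belowPoly, volume_pi]
  | succ N ih =>
    rw [volume_eq_lintegral_insertNth 0 (measurableSet_belowRegion _ _ _ _)]
    simp only [Fin.insertNth_zero', cons_mem_belowRegion]
    have hlo : max c (u - (N + 1) * h) ≤ u := max_le hcu (by nlinarith [N.cast_nonneg (α := ℝ)])
    rw [lintegral_eq_ofReal_of_Ioo (f := fun v => belowPoly h N (u - v) / N.factorial) hlo
      (by fun_prop)]
    · congr 1
      have hlen : u - max c (u - (N + 1) * h) = min (u - c) ((N + 1 : ℕ) * h) := by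
        push_cast
        rcases le_total c (u - (N + 1) * h) with h1 | h1
        · rw [max_eq_right h1, min_eq_right (by linarith)]
          ring
        · rw [max_eq_left h1, min_eq_left (by linarith)]
      rw [intervalIntegral.integral_comp_sub_left (fun v => belowPoly h N v / N.factorial) u,
        sub_self, hlen, intervalIntegral.integral_div,
        integral_belowPoly hh.le N (le_min (by linarith) (by positivity))
          (by push_cast; exact min_le_right _ _), belowPoly_min hh, Nat.factorial_succ]
      push_cast
      field_simp
    · intro v h1 h2
      exact div_nonneg (belowPoly_nonneg hh N (by linarith)) (by positivity)
    · intro v h1 h2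
      rw [max_lt_iff] at h1
      rw [← ih h2.le (by linarith)]
      congr 1
      ext y
      simp [h1, h2]
    · intro v hv
      have : {y : Fin N → ℝ | (c < v ∧ v < u ∧ u - ((N : ℝ) + 1) * h < v) ∧
          y ∈ belowRegion h N v u} = ∅ := by
        ext y
        simp only [Set.mem_ofPred_eq, Set.mem_empty_iff_false, iff_false]
        rintro ⟨⟨h1, h2, h3⟩, -⟩
        exact hv ⟨max_le h1.le h3.le, h2.le⟩
      rw [this, measure_empty]

/-- Integrating out the largest value. -/
theorem volume_aboveRegion {h : ℝ} (hh : 0 < h) (N : ℕ) {u b : ℝ} (hub : u ≤ b)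
    (hb : u + N * h ≤ b) :
    volume (aboveRegion h N u b) = ENNReal.ofReal (abovePoly h N (b - u) / N.factorial) := by
  induction N generalizing b with
  | zero =>
    have : aboveRegion h 0 u b = Set.univ := by
      ext y
      simp [aboveRegion, StrictMono]
    rw [this]
    simp [abovePoly, volume_pi]
  | succ N ih =>
    rw [volume_eq_lintegral_insertNth (Fin.last N) (measurableSet_aboveRegion _ _ _ _)]
    simp only [Fin.insertNth_last', snoc_mem_aboveRegion]
    push_cast at hb
    have hN : (0 : ℝ) ≤ N * h := by positivity
    rw [lintegral_eq_ofReal_of_Ioo (f := fun v => abovePoly h N (v - u) / N.factorial) hb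
      (by fun_prop)]
    · congr 1
      rw [intervalIntegral.integral_comp_sub_right (fun v => abovePoly h N v / N.factorial) u,
        add_sub_cancel_left, intervalIntegral.integral_div, ← Nat.cast_add_one,
        integral_abovePoly, Nat.factorial_succ]
      push_cast
      field_simp
    · intro v h1 h2
      exact div_nonneg (abovePoly_nonneg (by nlinarith) (by linarith)) (by positivity)
    · intro v h1 h2
      rw [← ih (by linarith) (by linarith)]
      congr 1
      ext y
      have : u < v := by linarith
      simp [h1.le, h2, this]
    · intro v hv
      have : {y : Fin N → ℝ | (u < v ∧ v < b ∧ u + ((N : ℝ) + 1) * h ≤ v) ∧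
          y ∈ aboveRegion h N u v} = ∅ := by
        ext y
        simp only [Set.mem_ofPred_eq, Set.mem_empty_iff_false, iff_false]
        rintro ⟨⟨h1, h2, h3⟩, -⟩
        exact hv ⟨h3, h2.le⟩
      rw [this, measure_empty]

theorem aboveRegion_eq_empty {h : ℝ} (N : ℕ) {u b : ℝ} (hb : b < u + N * h)
    (hub : u < b) : aboveRegion h N u b = ∅ := by
  rcases N with _ | N
  · simp at hb
    linarith
  · ext y
    simp only [aboveRegion, Set.mem_ofPred_eq, Set.mem_empty_iff_false, iff_false]
    rintro ⟨-, hy⟩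
    have := hy (Fin.last N)
    push_cast at hb
    simp at this
    linarith

/-- Ordered samples from `(0, 1)` whose smallest maximizer of `(i+1)/n - x i` is `k`, and for which
`x k ≤ z`. -/
def orderedRegion (n : ℕ) (z : ℝ) (k : Fin n) : Set (Fin n → ℝ) :=
  {x | StrictMono x ∧ (∀ i, 0 < x i ∧ x i < 1) ∧ x k ≤ z ∧
    (∀ i : Fin n, ((i : ℕ) + 1 : ℝ) / n - x i ≤ ((k : ℕ) + 1 : ℝ) / n - x k) ∧
    ∀ i : Fin n, i < k → ((i : ℕ) + 1 : ℝ) / n - x i < ((k : ℕ) + 1 : ℝ) / n - x k}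

theorem measurableSet_orderedRegion (n : ℕ) (z : ℝ) (k : Fin n) :
    MeasurableSet (orderedRegion n z k) := by
  have : orderedRegion n z k = {x : Fin n → ℝ | StrictMono x} ∩
      ((⋂ i : Fin n, {x : Fin n → ℝ | 0 < x i ∧ x i < 1}) ∩ ({x : Fin n → ℝ | x k ≤ z} ∩
      ((⋂ i : Fin n, {x : Fin n → ℝ |
        ((i : ℕ) + 1 : ℝ) / n - x i ≤ ((k : ℕ) + 1 : ℝ) / n - x k}) ∩
      ⋂ i : Fin n, ⋂ _ : i < k, {x : Fin n → ℝ |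
        ((i : ℕ) + 1 : ℝ) / n - x i < ((k : ℕ) + 1 : ℝ) / n - x k}))) := by
    ext x
    simp [orderedRegion]
  rw [this]
  refine (measurableSet_strictMono n).inter ((MeasurableSet.iInter fun i => ?_).inter
    (MeasurableSet.inter ?_ ((MeasurableSet.iInter fun i => ?_).inter
      (MeasurableSet.iInter fun i => MeasurableSet.iInter fun _ => ?_))))
  · measurability
  · measurability
  · exact measurableSet_le (by fun_prop) (by fun_prop)
  · exact measurableSet_lt (by fun_prop) (by fun_prop)

theorem Fin.forall_iff_left_mid_right {p q : ℕ} {P : Fin (p + q + 1) → Prop} :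
    (∀ i, P i) ↔ (∀ i : Fin p, P ⟨i, by omega⟩) ∧ P ⟨p, by omega⟩ ∧
      ∀ j : Fin q, P ⟨p + 1 + j, by omega⟩ := by
  refine ⟨fun h => ⟨fun i => h _, h _, fun j => h _⟩, fun ⟨h1, h2, h3⟩ i => ?_⟩
  rcases lt_trichotomy (i : ℕ) p with hi | hi | hi
  · exact h1 ⟨i, hi⟩
  · have : i = ⟨p, by omega⟩ := Fin.ext hi
    rw [this]
    exact h2
  · have := h3 ⟨i - (p + 1), by omega⟩
    have hh : i = ⟨p + 1 + (i - (p + 1)), by omega⟩ := Fin.ext (by simp; omega)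
    rw [hh]
    exact this

/-- The configuration with `y` on the left of `u` and `w` on the right of it. -/
def joinAt {p q : ℕ} (u : ℝ) (y : Fin p → ℝ) (w : Fin q → ℝ) : Fin (p + q + 1) → ℝ :=
  Fin.insertNth (α := fun _ => ℝ) ⟨p, by omega⟩ u (Fin.append y w)

section joinAt

variable {p q : ℕ} (u : ℝ) (y : Fin p → ℝ) (w : Fin q → ℝ)

theorem joinAt_left (i : Fin p) : joinAt u y w ⟨i, by omega⟩ = y i := by
  have : (⟨i, by omega⟩ : Fin (p + q + 1))
      = (⟨p, by omega⟩ : Fin (p + q + 1)).succAbove (Fin.castAdd q i) := by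
    rw [Fin.succAbove_of_castSucc_lt _ _ (by simp [Fin.lt_def])]
    rfl
  rw [joinAt, this, Fin.insertNth_apply_succAbove, Fin.append_left]

theorem joinAt_mid : joinAt u y w ⟨p, by omega⟩ = u := by
  rw [joinAt, Fin.insertNth_apply_same]

theorem joinAt_right (j : Fin q) : joinAt u y w ⟨p + 1 + j, by omega⟩ = w j := by
  have : (⟨p + 1 + j, by omega⟩ : Fin (p + q + 1))
      = (⟨p, by omega⟩ : Fin (p + q + 1)).succAbove (Fin.natAdd p j) := by
    rw [Fin.succAbove_of_le_castSucc _ _ (by simp [Fin.le_def])]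
    ext
    simp
    omega
  rw [joinAt, this, Fin.insertNth_apply_succAbove, Fin.append_right]

end joinAt

theorem joinAt_mem_orderedRegion {p q : ℕ} {z u : ℝ} {y : Fin p → ℝ} {w : Fin q → ℝ} :
    joinAt u y w ∈ orderedRegion (p + q + 1) z ⟨p, by omega⟩ ↔
      (0 < u ∧ u < 1 ∧ u ≤ z) ∧ y ∈ belowRegion (((p + q + 1 : ℕ) : ℝ)⁻¹) p 0 u ∧
        w ∈ aboveRegion (((p + q + 1 : ℕ) : ℝ)⁻¹) q u 1 := by
  have e1 : ∀ a : ℝ, ∀ i : ℕ, (((i : ℝ) + 1) / ((p + q + 1 : ℕ) : ℝ) - a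
      < ((p : ℝ) + 1) / ((p + q + 1 : ℕ) : ℝ) - u ↔
      u - ((p : ℝ) - i) * ((p + q + 1 : ℕ) : ℝ)⁻¹ < a) := by
    intro a i
    rw [div_eq_mul_inv, div_eq_mul_inv]
    constructor <;> intro h <;> linarith
  have e2 : ∀ a : ℝ, ∀ i : ℕ, ((((p + 1 + i : ℕ) : ℝ) + 1) / ((p + q + 1 : ℕ) : ℝ) - a
      ≤ ((p : ℝ) + 1) / ((p + q + 1 : ℕ) : ℝ) - u ↔
      u + ((i : ℝ) + 1) * ((p + q + 1 : ℕ) : ℝ)⁻¹ ≤ a) := by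
    intro a i
    rw [div_eq_mul_inv, div_eq_mul_inv, Nat.cast_add (p + 1) i, Nat.cast_add_one p]
    constructor <;> intro h <;> linarith
  simp only [orderedRegion, belowRegion, aboveRegion, Set.mem_ofPred_eq, StrictMono,
    Fin.forall_iff_left_mid_right, joinAt_left, joinAt_mid, joinAt_right, Fin.mk_lt_mk, e1, e2]
  constructor
  · rintro ⟨⟨hl, hm, hr⟩, ⟨h1, h2, h3⟩, hz, ⟨h4, -, h5⟩, h6, -⟩
    refine ⟨⟨h2.1, h2.2, hz⟩, ⟨fun i j hij => (hl i).1 j hij, fun i => ⟨(h1 i).1,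
      (hl i).2.1 i.2, h6 i i.2⟩⟩, fun i j hij => (hr i).2.2 j (by simpa using hij), fun i =>
      ⟨hm.2.2 i (by omega), (h3 i).2, h5 i⟩⟩
  · rintro ⟨⟨h0, h1, hz⟩, ⟨hy, hy'⟩, hw, hw'⟩
    refine ⟨⟨fun i => ⟨fun j hij => hy hij, fun _ => (hy' i).2.1, fun j _ =>
      (hy' i).2.1.trans (hw' j).1⟩, ⟨fun j hj => ?_, fun hj => ?_, fun j _ => (hw' j).1⟩, fun i =>
      ⟨fun j hj => ?_, fun hj => ?_, fun j hij => hw (by simpa using hij)⟩⟩,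
      ⟨fun i => ⟨(hy' i).1, (hy' i).2.1.trans h1⟩, ⟨h0, h1⟩, fun i => ⟨h0.trans (hw' i).1,
        (hw' i).2.1⟩⟩, hz, ⟨fun i => ?_, le_rfl, fun i => (hw' i).2.2⟩, fun i _ => (hy' i).2.2,
      fun hp => ?_, fun i hi => ?_⟩
    · omega
    · omega
    · omega
    · omega
    · exact ((e1 (y i) i).2 (hy' i).2.2).le
    · omega
    · omega

/-- Fubini's theorem for a set that, given one coordinate, is a product in the coordinates before
and after it. -/
theorem volume_preimage_append {p q : ℕ} {E : Set (Fin (p + q) → ℝ)} (hE : MeasurableSet E)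
    {A : Set (Fin p → ℝ)} {B : Set (Fin q → ℝ)}
    (h : ∀ y w, Fin.append y w ∈ E ↔ y ∈ A ∧ w ∈ B) :
    volume E = volume A * volume B := by
  have h1 := volume_measurePreserving_sumPiEquivProdPi_symm (fun _ : Fin p ⊕ Fin q => ℝ)
  have h2 := volume_measurePreserving_piCongrLeft (fun _ : Fin (p + q) => ℝ) finSumFinEquiv
  have h3 := h2.comp h1
  rw [← h3.measure_preimage hE.nullMeasurableSet, ← Measure.prod_prod, ← Measure.volume_eq_prod]
  congr 1
  ext ⟨y, w⟩
  rw [Set.mem_prod, ← h, Set.mem_preimage]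
  have : ((MeasurableEquiv.piCongrLeft (fun _ : Fin (p + q) => ℝ) finSumFinEquiv) ∘
      (MeasurableEquiv.sumPiEquivProdPi (fun _ : Fin p ⊕ Fin q => ℝ)).symm) (y, w)
      = Fin.append y w := by
    funext i
    refine Fin.addCases (fun i => ?_) (fun i => ?_) i
    · rw [Fin.append_left, Function.comp_apply, MeasurableEquiv.coe_piCongrLeft,
        ← finSumFinEquiv_apply_left, Equiv.piCongrLeft_apply_apply]
      rfl
    · rw [Fin.append_right, Function.comp_apply, MeasurableEquiv.coe_piCongrLeft,
        ← finSumFinEquiv_apply_right, Equiv.piCongrLeft_apply_apply]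
      rfl
  rw [this]

theorem qFormula_nonneg (p q : ℕ) {z : ℝ} (hz : 0 ≤ z) (hz1 : z < 1) :
    0 ≤ qFormula (p + q + 1) z (p + 1) := by
  have hpos : (0 : ℝ) < ((p + q + 1 : ℕ) : ℝ) := by positivity
  rw [← factorial_mul_integral_eq_qFormula (show p + q + 1 = p + 1 + q by ring) hz hz1]
  refine mul_nonneg (by positivity)
    (intervalIntegral.integral_nonneg (by positivity) fun v hv => ?_)
  have h2 : v ≤ ((p : ℝ) + 1) * ((p + q + 1 : ℕ) : ℝ)⁻¹ := by
    have := hv.2.trans (min_le_right _ _)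
    rwa [div_eq_mul_inv, Nat.cast_add_one] at this
  have hn : ((p : ℝ) + q + 1) * ((p + q + 1 : ℕ) : ℝ)⁻¹ = 1 := by
    rw [show ((p : ℝ) + q + 1) = ((p + q + 1 : ℕ) : ℝ) by push_cast; ring]
    field_simp
  have h3 : 0 ≤ (q : ℝ) * ((p + q + 1 : ℕ) : ℝ)⁻¹ := by positivity
  exact mul_nonneg (div_nonneg (belowPoly_nonneg (by positivity) _ hv.1) (by positivity))
    (div_nonneg (abovePoly_nonneg (by linarith) (by linarith)) (by positivity))

theorem volume_orderedRegion (p q : ℕ) {z : ℝ} (hz : 0 ≤ z) (hz1 : z < 1) :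
    volume (orderedRegion (p + q + 1) z ⟨p, by omega⟩) =
      ENNReal.ofReal (qFormula (p + q + 1) z (p + 1) / (p + q + 1).factorial) := by
  set h : ℝ := (((p + q + 1 : ℕ) : ℝ))⁻¹ with hh
  have hpos : 0 < h := by positivity
  have hn : ((p : ℝ) + q + 1) * h = 1 := by
    rw [hh]
    push_cast
    field_simp
  rw [volume_eq_lintegral_insertNth ⟨p, by omega⟩ (measurableSet_orderedRegion _ _ _)]
  have hslice : ∀ u : ℝ, volume {x : Fin (p + q) → ℝ |
      Fin.insertNth (α := fun _ => ℝ) (⟨p, by omega⟩ : Fin (p + q + 1)) u x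
        ∈ orderedRegion (p + q + 1) z ⟨p, by omega⟩}
      = if 0 < u ∧ u < 1 ∧ u ≤ z then
          volume (belowRegion h p 0 u) * volume (aboveRegion h q u 1) else 0 := by
    intro u
    have hE : MeasurableSet {x : Fin (p + q) → ℝ |
      Fin.insertNth (α := fun _ => ℝ) (⟨p, by omega⟩ : Fin (p + q + 1)) u x
        ∈ orderedRegion (p + q + 1) z ⟨p, by omega⟩} := by
      refine (measurableSet_orderedRegion _ _ _).preimage ?_
      exact ((MeasurableEquiv.piFinSuccAbove (fun _ : Fin (p + q + 1) => ℝ)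
        ⟨p, by omega⟩).symm.measurable).comp measurable_prodMk_left
    split_ifs with hu
    · refine volume_preimage_append hE fun y w => ?_
      have := joinAt_mem_orderedRegion (z := z) (u := u) (y := y) (w := w)
      rw [← hh] at this
      simp only [hu, and_self, true_and] at this
      exact this
    · rw [volume_preimage_append hE (A := ∅) (B := ∅) fun y w => ?_]
      · simp
      · have := joinAt_mem_orderedRegion (z := z) (u := u) (y := y) (w := w)
        simp only [hu, false_and, iff_false] at this
        simpa [joinAt] using this
  simp only [hslice]
  have hw0 : 0 ≤ min z (((p + 1 : ℕ) : ℝ) / (p + q + 1 : ℕ)) := by positivity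
  rw [← factorial_mul_integral_eq_qFormula (show p + q + 1 = p + 1 + q by ring) hz hz1,
    mul_div_cancel_left₀ _ (by positivity), ← hh]
  have hmid : ((p + 1 : ℕ) : ℝ) / (p + q + 1 : ℕ) = ((p : ℝ) + 1) * h := by
    rw [hh, div_eq_mul_inv]
    push_cast
    ring
  rw [hmid] at hw0 ⊢
  have hab : ∀ v : ℝ, v < ((p : ℝ) + 1) * h → v < 1 ∧ v + q * h ≤ 1 := by
    intro v hv
    have : 0 ≤ (q : ℝ) * h := by positivity
    constructor <;> linarith
  refine lintegral_eq_ofReal_of_Ioo hw0 (by fun_prop) ?_ ?_ ?_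
  · intro v h1 h2
    obtain ⟨h3, h4⟩ := lt_min_iff.1 h2
    obtain ⟨h5, h6⟩ := hab v h4
    exact mul_nonneg (div_nonneg (belowPoly_nonneg hpos _ h1.le) (by positivity))
      (div_nonneg (abovePoly_nonneg (by linarith) (by linarith)) (by positivity))
  · intro v h1 h2
    obtain ⟨h3, h4⟩ := lt_min_iff.1 h2
    obtain ⟨h5, h6⟩ := hab v h4
    rw [if_pos ⟨h1, h5, h3.le⟩, volume_belowRegion hpos p h1.le (by linarith),
      volume_aboveRegion hpos q h5.le h6, sub_zero, ← ENNReal.ofReal_mul]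
    exact div_nonneg (belowPoly_nonneg hpos _ h1.le) (by positivity)
  · intro v hv
    split_ifs with hu
    · have : ((p : ℝ) + 1) * h < v := by
        by_contra! hc
        exact hv ⟨hu.1.le, le_min hu.2.2 hc⟩
      rw [aboveRegion_eq_empty q (by linarith) hu.2.1]
      simp
    · rfl

/-! ### Order statistics and the maximizing rank -/

theorem orderStat_monotone {n : ℕ} (x : Fin n → ℝ) : Monotone (orderStat x) :=
  Tuple.monotone_sort x

/-- A monotone transformation commutes with sorting, however ties are broken. -/
theorem apply_orderStat_eq {n : ℕ} {F₀ : ℝ → ℝ} (hF : Monotone F₀) (x : Fin n → ℝ)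
    (σ : Equiv.Perm (Fin n)) (hσ : Monotone fun i => F₀ (x (σ i))) (i : Fin n) :
    F₀ (orderStat x i) = F₀ (x (σ i)) :=
  congrFun (Tuple.unique_monotone (f := fun i => F₀ (x i)) (σ := Tuple.sort x) (τ := σ)
    (hF.comp (Tuple.monotone_sort x)) hσ) i

theorem argmaxIndex_le {n : ℕ} [NeZero n] (F₀ : ℝ → ℝ) (x : Fin n → ℝ) (i : Fin n) :
    (((i : ℕ) + 1 : ℕ) : ℝ) / n - F₀ (orderStat x i)
      ≤ (((argmaxIndex F₀ x : ℕ) + 1 : ℕ) : ℝ) / n - F₀ (orderStat x (argmaxIndex F₀ x)) :=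
  (Finset.mem_filter.1 (Finset.min'_mem _ (maxIndices_nonempty F₀ x))).2 i

theorem argmaxIndex_eq_iff {n : ℕ} [NeZero n] (F₀ : ℝ → ℝ) (x : Fin n → ℝ) (k : Fin n) :
    argmaxIndex F₀ x = k ↔
      (∀ i : Fin n, ((i : ℕ) + 1 : ℝ) / n - F₀ (orderStat x i)
        ≤ ((k : ℕ) + 1 : ℝ) / n - F₀ (orderStat x k)) ∧
      ∀ i : Fin n, i < k → ((i : ℕ) + 1 : ℝ) / n - F₀ (orderStat x i)
        < ((k : ℕ) + 1 : ℝ) / n - F₀ (orderStat x k) := by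
  constructor
  · rintro rfl
    refine ⟨fun i => by exact_mod_cast argmaxIndex_le F₀ x i, fun i hi => ?_⟩
    by_contra! hc
    have hmem : i ∈ maxIndices F₀ x := by
      refine Finset.mem_filter.2 ⟨Finset.mem_univ i, fun j => (argmaxIndex_le F₀ x j).trans ?_⟩
      exact_mod_cast hc
    exact absurd (Finset.min'_le _ i hmem) (not_le.2 hi)
  · rintro ⟨h1, h2⟩
    refine le_antisymm (Finset.min'_le _ k (Finset.mem_filter.2 ⟨Finset.mem_univ k, fun i => ?_⟩)) ?_
    · exact_mod_cast h1 i
    · by_contra! hc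
      have h3 := h2 _ hc
      have h4 := argmaxIndex_le F₀ x k
      push_cast at h4
      linarith

theorem argmaxRank_eq_iff_mem_orderedRegion {n : ℕ} [NeZero n] {F₀ : ℝ → ℝ} (hF : Monotone F₀)
    {x : Fin n → ℝ} {σ : Equiv.Perm (Fin n)} (hσ : StrictMono fun i => F₀ (x (σ i)))
    (hx : ∀ i, 0 < F₀ (x i) ∧ F₀ (x i) < 1) (z : ℝ) (k : Fin n) :
    (U_R F₀ x ≤ z ∧ argmaxRank F₀ x = k + 1) ↔
      (fun i => F₀ (x (σ i))) ∈ orderedRegion n z k := by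
  have h := apply_orderStat_eq hF x σ hσ.monotone
  have hk : argmaxRank F₀ x = k + 1 ↔ argmaxIndex F₀ x = k := by
    rw [argmaxRank, Nat.add_right_cancel_iff, Fin.ext_iff]
  rw [hk]
  have : (U_R F₀ x ≤ z ∧ argmaxIndex F₀ x = k)
      ↔ (F₀ (orderStat x k) ≤ z ∧ argmaxIndex F₀ x = k) :=
    and_congr_left fun hk => by rw [U_R, hk]
  rw [this, argmaxIndex_eq_iff]
  simp only [h, orderedRegion, Set.mem_ofPred_eq, hσ, true_and]
  exact (and_iff_right fun i => hx _).symm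

/-- The empirical distribution function at `t` is `m / n`, where `m` is the number of order
statistics that are at most `t`. -/
theorem empCDF_eq {n : ℕ} (x : Fin n → ℝ) (t : ℝ) :
    empCDF x t = ((Finset.univ.filter fun i => orderStat x i ≤ t).card : ℝ) / n := by
  rw [empCDF, ← Equiv.sum_comp (Tuple.sort x), Finset.sum_boole, one_div, inv_mul_eq_div]
  rfl

/-- The supremum is attained at the observation of rank `R`. -/
theorem smirnovStat_eq {n : ℕ} [NeZero n] {F₀ : ℝ → ℝ} (hF : Monotone F₀)
    (h0 : ∀ t, 0 ≤ F₀ t) (h1 : ∀ t, F₀ t ≤ 1) (x : Fin n → ℝ) :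
    smirnovStat F₀ x = (argmaxRank F₀ x : ℝ) / n - U_R F₀ x ∧ 0 ≤ smirnovStat F₀ x := by
  have hn : (0 : ℝ) < n := by exact_mod_cast Nat.pos_of_ne_zero (NeZero.ne n)
  have hnn : 0 < n := Nat.pos_of_ne_zero (NeZero.ne n)
  have hmax : ∀ i : Fin n, (((i : ℕ) + 1 : ℕ) : ℝ) / n - F₀ (orderStat x i)
      ≤ (argmaxRank F₀ x : ℝ) / n - U_R F₀ x := argmaxIndex_le F₀ x
  have hnonneg : 0 ≤ (argmaxRank F₀ x : ℝ) / n - U_R F₀ x := by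
    refine le_trans ?_ (hmax ⟨n - 1, by omega⟩)
    have : ((n - 1 + 1 : ℕ) : ℝ) / n = 1 := by
      rw [Nat.sub_add_cancel hnn]
      field_simp
    simp only [this]
    linarith [h1 (orderStat x ⟨n - 1, by omega⟩)]
  have hub : ∀ t, empCDF x t - F₀ t ≤ (argmaxRank F₀ x : ℝ) / n - U_R F₀ x := by
    intro t
    rw [empCDF_eq]
    rcases hm : (Finset.univ.filter fun i => orderStat x i ≤ t).card with _ | m
    · simp
      linarith [h0 t]
    · have hmn : m < n := by
        have := Finset.card_filter_le (Finset.univ : Finset (Fin n)) fun i => orderStat x i ≤ t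
        rw [hm, Finset.card_fin] at this
        omega
      have hle : orderStat x ⟨m, hmn⟩ ≤ t :=
        (Tuple.lt_card_le_iff_apply_le_of_monotone (orderStat_monotone x)).1 (by rw [hm]; simp)
      have := hmax ⟨m, hmn⟩
      have := hF hle
      simp only at *
      linarith
  have heq : smirnovStat F₀ x = (argmaxRank F₀ x : ℝ) / n - U_R F₀ x := by
    refine le_antisymm (ciSup_le hub) ?_
    refine le_trans ?_ (le_ciSup ⟨_, Set.forall_mem_range.2 hub⟩
      (orderStat x (argmaxIndex F₀ x)))
    rw [empCDF_eq]
    have : argmaxRank F₀ x ≤ (Finset.univ.filter fun i =>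
        orderStat x i ≤ orderStat x (argmaxIndex F₀ x)).card :=
      (Tuple.lt_card_le_iff_apply_le_of_monotone (orderStat_monotone x)).2 le_rfl
    have h2 : (argmaxRank F₀ x : ℝ) / n ≤ ((Finset.univ.filter fun i =>
        orderStat x i ≤ orderStat x (argmaxIndex F₀ x)).card : ℝ) / n := by
      gcongr
    exact sub_le_sub_right h2 _
  exact ⟨heq, heq ▸ hnonneg⟩

/-! ### The root of the quadratic equation -/

theorem sRoot_spec {c x : ℝ} (hc : 0 < c) (hc1 : c ≤ 1) (hx : 0 < x) :
    0 < sRoot c x ∧ sRoot c x < c ∧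
      (c - sRoot c x) ^ 2 = x ^ 2 * (sRoot c x * (1 - sRoot c x)) := by
  have hcc : 0 ≤ 4 * c * (1 - c) := by
    have : 0 ≤ 1 - c := by linarith
    positivity
  have hD : √(4 * c * (1 - c) + x ^ 2) ^ 2 = 4 * c * (1 - c) + x ^ 2 :=
    Real.sq_sqrt (by positivity)
  have hD0 : x ≤ √(4 * c * (1 - c) + x ^ 2) := Real.le_sqrt_of_sq_le (by linarith)
  set D := √(4 * c * (1 - c) + x ^ 2)
  have hs : sRoot c x = (2 * c + x ^ 2 - x * D) / (2 * (1 + x ^ 2)) := rfl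
  have hden : 0 < 2 * (1 + x ^ 2) := by positivity
  refine ⟨?_, ?_, ?_⟩
  · rw [hs]
    refine div_pos ?_ hden
    have : (x * D) ^ 2 < (2 * c + x ^ 2) ^ 2 := by
      rw [mul_pow, hD]
      nlinarith [mul_pos (pow_pos hc 2) hden]
    linarith [lt_of_pow_lt_pow_left₀ 2 (by positivity) this]
  · rw [hs, div_lt_iff₀ hden]
    -- `x (1 - 2 c) < x ≤ D`
    nlinarith [mul_pos hx hc, mul_le_mul_of_nonneg_left hD0 hx.le, mul_pos hc (pow_pos hx 2)]
  · rw [hs]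
    field_simp
    linear_combination ((1 + x ^ 2) * x ^ 2) * hD

/-- For `u ≤ c`, the ratio `(c - u) / √(u (1 - u))` exceeds `x` exactly when `u` lies below the
root. -/
theorem mul_sqrt_lt_sub_iff {c x u : ℝ} (hc : 0 < c) (hc1 : c ≤ 1) (hx : 0 < x) (hu : 0 < u)
    (hu1 : u < 1) (huc : u ≤ c) : x * √(u * (1 - u)) < c - u ↔ u < sRoot c x := by
  obtain ⟨hs0, hsc, hs⟩ := sRoot_spec hc hc1 hx
  set s := sRoot c x
  have hsq : (x * √(u * (1 - u))) ^ 2 = x ^ 2 * (u * (1 - u)) := by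
    rw [mul_pow, Real.sq_sqrt (mul_nonneg hu.le (by linarith))]
  have hfac : (c - u) ^ 2 - x ^ 2 * (u * (1 - u))
      = (s - u) * (2 * c + x ^ 2 - (1 + x ^ 2) * (u + s)) := by
    linear_combination hs
  have hbr : 0 ≤ 2 * c + x ^ 2 - (1 + x ^ 2) * (c + s) := by
    have h1 : (c - s) * (2 * c + x ^ 2 - (1 + x ^ 2) * (c + s)) = x ^ 2 * (c * (1 - c)) := by
      linear_combination hs
    have h2 : 0 ≤ x ^ 2 * (c * (1 - c)) :=
      mul_nonneg (by positivity) (mul_nonneg hc.le (by linarith))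
    rw [← h1] at h2
    exact nonneg_of_mul_nonneg_right h2 (by linarith)
  have hx2 : 0 < 1 + x ^ 2 := by positivity
  rw [← pow_lt_pow_iff_left₀ (by positivity) (by linarith) two_ne_zero, hsq, ← sub_pos, hfac]
  constructor
  · intro h
    by_contra! hsu
    have : 0 ≤ 2 * c + x ^ 2 - (1 + x ^ 2) * (u + s) := by nlinarith
    nlinarith
  · intro h
    exact mul_pos (by linarith) (by nlinarith)

/-! ### The probability integral transform -/

/-- A continuous distribution function applied to its random variable is uniform on `(0, 1)`. -/
theorem map_cdf_comp_eq_uniform {Ω : Type*} [MeasurableSpace Ω] {P : Measure Ω}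
    [IsProbabilityMeasure P] {X : Ω → ℝ} {F₀ : ℝ → ℝ} (hX : Measurable X) (hF₀ : Continuous F₀)
    (hcdf : ∀ t, P.real {ω | X ω ≤ t} = F₀ t) :
    P.map (fun ω => F₀ (X ω)) = volume.restrict (Set.Ioo 0 1) := by
  have : IsProbabilityMeasure (P.map X) := Measure.isProbabilityMeasure_map hX.aemeasurable
  have hF : ∀ t, F₀ t = cdf (P.map X) t := by
    intro t
    rw [cdf_eq_real, map_measureReal_apply hX measurableSet_Iic, ← hcdf]
    rfl
  have hmono : Monotone F₀ := fun a b hab => by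
    rw [hF, hF]
    exact monotone_cdf _ hab
  have hF0 : ∀ t, 0 ≤ F₀ t := fun t => by
    rw [← hcdf]
    exact measureReal_nonneg
  have hF1 : ∀ t, F₀ t ≤ 1 := fun t => by
    rw [← hcdf]
    exact measureReal_le_one
  have hsurj : ∀ t, 0 < t → t < 1 → ∃ a, F₀ a = t := by
    intro t h0 h1
    have hbot : Filter.Tendsto F₀ Filter.atBot (nhds 0) :=
      (tendsto_cdf_atBot (P.map X)).congr fun t => (hF t).symm
    have htop : Filter.Tendsto F₀ Filter.atTop (nhds 1) :=
      (tendsto_cdf_atTop (P.map X)).congr fun t => (hF t).symm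
    obtain ⟨a, ha⟩ := (hbot.eventually_lt_const h0).exists
    obtain ⟨b, hb⟩ := (htop.eventually_const_lt h1).exists
    exact mem_range_of_exists_le_of_exists_ge hF₀ ⟨a, ha.le⟩ ⟨b, hb.le⟩
  have hU : Measurable fun ω => F₀ (X ω) := hF₀.measurable.comp hX
  have : IsProbabilityMeasure (P.map fun ω => F₀ (X ω)) :=
    Measure.isProbabilityMeasure_map hU.aemeasurable
  refine Measure.ext_of_Iic _ _ fun t => ?_
  rw [Measure.map_apply hU measurableSet_Iic, Measure.restrict_apply measurableSet_Iic]
  rcases lt_or_ge t 0 with ht | ht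
  · have h1 : (fun ω => F₀ (X ω)) ⁻¹' Set.Iic t = ∅ := by
      ext ω
      simpa using ht.trans_le (hF0 _)
    have h2 : Set.Iic t ∩ Set.Ioo 0 1 = ∅ := by
      ext u
      simp
      intros
      linarith
    rw [h1, h2]
    simp
  rcases lt_or_ge t 1 with ht1 | ht1
  · have h2 : Set.Iic t ∩ Set.Ioo 0 1 = Set.Ioc 0 t := by
      ext u
      simp
      constructor
      · rintro ⟨h1, h2, h3⟩
        exact ⟨h2, h1⟩
      · rintro ⟨h1, h2⟩
        exact ⟨h2, h1, by linarith⟩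
    rw [h2, Real.volume_Ioc, sub_zero, ← ofReal_measureReal]
    congr 1
    refine le_antisymm (le_of_forall_gt_imp_ge_of_dense fun t' ht' => ?_) ?_
    · rcases lt_or_ge t' 1 with h1 | h1
      · obtain ⟨a, ha⟩ := hsurj t' (by linarith) h1
        rw [← ha, ← hcdf]
        refine measureReal_mono fun ω hω => ?_
        have hω' : F₀ (X ω) ≤ t := hω
        by_contra hc
        have := hmono (not_le.1 hc).le
        linarith
      · exact measureReal_le_one.trans h1
    · rcases ht.eq_or_lt with rfl | h0
      · exact measureReal_nonneg
      · obtain ⟨a, rfl⟩ := hsurj t h0 ht1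
        conv_lhs => rw [← hcdf]
        exact measureReal_mono fun ω hω => hmono hω
  · have h1 : (fun ω => F₀ (X ω)) ⁻¹' Set.Iic t = Set.univ := by
      ext ω
      simpa using (hF1 _).trans ht1
    have h2 : Set.Iic t ∩ Set.Ioo 0 1 = Set.Ioo (0 : ℝ) 1 := by
      ext u
      simp
      intros
      linarith
    rw [h1, h2]
    simp

/-! ### Summing over the orderings of the sample -/

section Uniform

variable {Ω : Type*} [MeasurableSpace Ω] {P : Measure Ω} {n : ℕ}
  {U : Fin n → Ω → ℝ}

theorem ae_ne_const {V : Ω → ℝ} (hV : Measurable V)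
    (hlaw : P.map V = volume.restrict (Set.Ioo 0 1)) (a : ℝ) : ∀ᵐ ω ∂P, V ω ≠ a := by
  have : ∀ᵐ v ∂(P.map V), v ≠ a := by
    rw [hlaw]
    exact Measure.ae_ne _ a
  exact ae_of_ae_map hV.aemeasurable this

theorem ae_mem_Ioo (hU : ∀ i, Measurable (U i))
    (hlaw : ∀ i, P.map (U i) = volume.restrict (Set.Ioo 0 1)) :
    ∀ᵐ ω ∂P, ∀ i, 0 < U i ω ∧ U i ω < 1 := by
  rw [ae_all_iff]
  intro i
  have : ∀ᵐ v ∂(P.map (U i)), v ∈ Set.Ioo (0 : ℝ) 1 := by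
    rw [hlaw]
    exact ae_restrict_mem measurableSet_Ioo
  exact ae_of_ae_map (hU i).aemeasurable this

variable [IsProbabilityMeasure P]

/-- Ties have probability zero. -/
theorem ae_injective (hU : ∀ i, Measurable (U i)) (hindep : iIndepFun U P)
    (hlaw : ∀ i, P.map (U i) = volume.restrict (Set.Ioo 0 1)) :
    ∀ᵐ ω ∂P, Function.Injective fun i => U i ω := by
  have h : ∀ i j : Fin n, i ≠ j → ∀ᵐ ω ∂P, U i ω ≠ U j ω := by
    intro i j hij
    have hprod := (indepFun_iff_map_prod_eq_prod_map_map (hU i).aemeasurable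
      (hU j).aemeasurable).1 (hindep.indepFun hij)
    have hd : MeasurableSet {p : ℝ × ℝ | p.1 = p.2} :=
      measurableSet_eq_fun measurable_fst measurable_snd
    have hae : ∀ᵐ p ∂(P.map fun ω => (U i ω, U j ω)), p.1 ≠ p.2 := by
      rw [hprod, hlaw, hlaw, ae_iff]
      simp only [ne_eq, not_not]
      rw [Measure.measure_prod_null hd]
      refine ae_of_all _ fun a => ?_
      have : Prod.mk a ⁻¹' {p : ℝ × ℝ | p.1 = p.2} = {a} := by
        ext b
        simp [eq_comm]
      change volume.restrict (Set.Ioo (0 : ℝ) 1) (Prod.mk a ⁻¹' {p : ℝ × ℝ | p.1 = p.2}) = 0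
      rw [this]
      simp
    exact ae_of_ae_map ((hU i).prodMk (hU j)).aemeasurable hae
  have h' : ∀ᵐ ω ∂P, ∀ i j : Fin n, i ≠ j → U i ω ≠ U j ω := by
    simp only [ae_all_iff]
    exact h
  filter_upwards [h'] with ω hω i j hij
  by_contra hne
  exact hω i j hne hij

theorem ae_exists_perm_strictMono (hU : ∀ i, Measurable (U i)) (hindep : iIndepFun U P)
    (hlaw : ∀ i, P.map (U i) = volume.restrict (Set.Ioo 0 1)) :
    ∀ᵐ ω ∂P, ∃ σ : Equiv.Perm (Fin n), StrictMono fun i => U (σ i) ω := by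
  filter_upwards [ae_injective hU hindep hlaw] with ω hω
  exact ⟨Tuple.sort fun i => U i ω, (Tuple.monotone_sort fun i => U i ω).strictMono_of_injective
    (hω.comp (Tuple.sort _).injective)⟩

theorem measure_perm_mem_orderedRegion (hU : ∀ i, Measurable (U i)) (hindep : iIndepFun U P)
    (hlaw : ∀ i, P.map (U i) = volume.restrict (Set.Ioo 0 1)) (σ : Equiv.Perm (Fin n))
    (z : ℝ) (k : Fin n) :
    P {ω | (fun i => U (σ i) ω) ∈ orderedRegion n z k} = volume (orderedRegion n z k) := by
  have hmap : P.map (fun ω i => U (σ i) ω) =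
      volume.restrict (Set.univ.pi fun _ : Fin n => Set.Ioo (0 : ℝ) 1) := by
    rw [(iIndepFun_iff_map_fun_eq_pi_map fun i => (hU (σ i)).aemeasurable).1
      (hindep.precomp σ.injective), volume_pi, Measure.restrict_pi_pi]
    congr 1
    funext i
    exact hlaw _
  have hmeas : Measurable (fun ω i => U (σ i) ω) := measurable_pi_lambda _ fun i => hU _
  have h := Measure.map_apply (μ := P) hmeas (measurableSet_orderedRegion n z k)
  rw [hmap, Measure.restrict_apply (measurableSet_orderedRegion n z k)] at h
  have hsub : orderedRegion n z k ⊆ Set.univ.pi fun _ : Fin n => Set.Ioo (0 : ℝ) 1 :=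
    fun x hx i _ => hx.2.1 i
  rw [Set.inter_eq_left.2 hsub] at h
  exact h.symm

theorem measure_iUnion_perm (hU : ∀ i, Measurable (U i)) (hindep : iIndepFun U P)
    (hlaw : ∀ i, P.map (U i) = volume.restrict (Set.Ioo 0 1)) (z : ℝ) (k : Fin n) :
    P (⋃ σ : Equiv.Perm (Fin n), {ω | (fun i => U (σ i) ω) ∈ orderedRegion n z k})
      = n.factorial * volume (orderedRegion n z k) := by
  rw [measure_iUnion]
  · simp only [measure_perm_mem_orderedRegion hU hindep hlaw]
    rw [tsum_fintype, Finset.sum_const, Finset.card_univ, Fintype.card_perm, Fintype.card_fin,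
      nsmul_eq_mul]
  · intro σ τ hne
    refine Set.disjoint_left.2 fun ω h1 h2 => hne ?_
    have h3 : StrictMono ((fun i => U i ω) ∘ σ) := h1.1
    have h4 : StrictMono ((fun i => U i ω) ∘ τ) := h2.1
    have h5 := Tuple.unique_monotone h3.monotone h4.monotone
    have hinj : Function.Injective fun i => U i ω :=
      (Function.Injective.of_comp_iff' _ σ.bijective).1 h3.injective
    exact Equiv.ext fun i => hinj (congrFun h5 i)
  · intro σ
    exact (measurableSet_orderedRegion n z k).preimage (measurable_pi_lambda _ fun i => hU _)

end Uniform

/-- The joint law of `F₀(X_{R:n})` and `R`, with `R` counted from zero. -/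
theorem measure_U_R_le_and_argmaxRank_eq {Ω : Type*} [MeasurableSpace Ω] {P : Measure Ω}
    [IsProbabilityMeasure P] {n : ℕ} [NeZero n] {X : Fin n → Ω → ℝ} {F₀ : ℝ → ℝ}
    (hF : Monotone F₀) (hU : ∀ i, Measurable fun ω => F₀ (X i ω))
    (hindep : iIndepFun (fun i ω => F₀ (X i ω)) P)
    (hlaw : ∀ i, P.map (fun ω => F₀ (X i ω)) = volume.restrict (Set.Ioo 0 1))
    {z : ℝ} (hz : 0 ≤ z) (hz1 : z < 1) (k : Fin n) :
    NullMeasurableSet {ω | U_R F₀ (fun i => X i ω) ≤ z ∧ argmaxRank F₀ (fun i => X i ω) = k + 1} P ∧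
    P.real {ω | U_R F₀ (fun i => X i ω) ≤ z ∧ argmaxRank F₀ (fun i => X i ω) = k + 1}
      = qFormula n z (k + 1) := by
  have hae : {ω | U_R F₀ (fun i => X i ω) ≤ z ∧ argmaxRank F₀ (fun i => X i ω) = k + 1}
      =ᵐ[P] ⋃ σ : Equiv.Perm (Fin n),
        {ω | (fun i => F₀ (X (σ i) ω)) ∈ orderedRegion n z k} := by
    rw [Filter.eventuallyEq_set]
    filter_upwards [ae_exists_perm_strictMono hU hindep hlaw, ae_mem_Ioo hU hlaw] with ω hω hI
    obtain ⟨σ, hσ⟩ := hω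
    simp only [Set.mem_iUnion, Set.mem_ofPred_eq]
    constructor
    · intro h
      exact ⟨σ, (argmaxRank_eq_iff_mem_orderedRegion hF hσ hI z k).1 h⟩
    · rintro ⟨τ, hτ⟩
      exact (argmaxRank_eq_iff_mem_orderedRegion hF hτ.1 hI z k).2 hτ
  refine ⟨NullMeasurableSet.congr ?_ hae.symm, ?_⟩
  · exact (MeasurableSet.iUnion fun σ => (measurableSet_orderedRegion n z k).preimage
      (measurable_pi_lambda _ fun i => hU _)).nullMeasurableSet
  · rw [measureReal_congr hae, measureReal_def, measure_iUnion_perm hU hindep hlaw]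
    obtain ⟨k, hk⟩ := k
    obtain ⟨q, rfl⟩ := Nat.exists_eq_add_of_lt hk
    rw [volume_orderedRegion k q hz hz1, ENNReal.toReal_mul, ENNReal.toReal_natCast,
      ENNReal.toReal_ofReal (div_nonneg (qFormula_nonneg k q hz hz1) (by positivity))]
    field_simp

end

/-! ### The law of `W_n^*` -/

/-- When `F₀(X_{R:n})` lies in `(0, 1)`, which is almost sure, `x < W_n^*` means that
`F₀(X_{R:n})` lies below the root `s(R/n, x)`. -/
theorem lt_WStar_iff {n : ℕ} [NeZero n] {F₀ : ℝ → ℝ} (hF : Monotone F₀)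
    (h0 : ∀ t, 0 ≤ F₀ t) (h1 : ∀ t, F₀ t ≤ 1) {y : Fin n → ℝ}
    (hU : 0 < U_R F₀ y ∧ U_R F₀ y < 1) {x : ℝ} (hx : 0 < x) :
    x < WStar F₀ y ↔ U_R F₀ y < sRoot ((argmaxRank F₀ y : ℝ) / n) x := by
  obtain ⟨hs, hs0⟩ := smirnovStat_eq hF h0 h1 y
  have hn : (0 : ℝ) < n := by exact_mod_cast Nat.pos_of_ne_zero (NeZero.ne n)
  have hc1 : (argmaxRank F₀ y : ℝ) / n ≤ 1 := by
    rw [div_le_one hn, Nat.cast_le]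
    exact (argmaxIndex F₀ y).2
  have hsqrt : 0 < √(U_R F₀ y * (1 - U_R F₀ y)) :=
    Real.sqrt_pos.2 (mul_pos hU.1 (by linarith [hU.2]))
  rw [WStar, lt_div_iff₀ hsqrt, hs]
  exact mul_sqrt_lt_sub_iff (by linarith [hU.1]) hc1 hx hU.1 hU.2 (by linarith)

theorem WStar_pos {n : ℕ} [NeZero n] {F₀ : ℝ → ℝ} (hF : Monotone F₀)
    (h0 : ∀ t, 0 ≤ F₀ t) (h1 : ∀ t, F₀ t ≤ 1) {y : Fin n → ℝ}
    (hy : ∀ i, 0 < F₀ (y i) ∧ F₀ (y i) < 1) : 0 < WStar F₀ y := by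
  have hn : (0 : ℝ) < n := by exact_mod_cast Nat.pos_of_ne_zero (NeZero.ne n)
  have hnn : 0 < n := Nat.pos_of_ne_zero (NeZero.ne n)
  have hU : 0 < U_R F₀ y ∧ U_R F₀ y < 1 := hy _
  have hsqrt : 0 < √(U_R F₀ y * (1 - U_R F₀ y)) :=
    Real.sqrt_pos.2 (mul_pos hU.1 (by linarith [hU.2]))
  refine div_pos ?_ hsqrt
  rw [(smirnovStat_eq hF h0 h1 y).1]
  -- The largest observation alone contributes `1 - F₀(X_{n:n}) > 0`.
  refine lt_of_lt_of_le ?_ (argmaxIndex_le F₀ y ⟨n - 1, by omega⟩)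
  have : ((n - 1 + 1 : ℕ) : ℝ) / n = 1 := by
    rw [Nat.sub_add_cancel hnn]
    field_simp
  simp only [this]
  have h := (hy (Tuple.sort y ⟨n - 1, by omega⟩)).2
  exact sub_pos.2 h

theorem theorem2p1 {Ω : Type*} [MeasurableSpace Ω] (P : Measure Ω) [IsProbabilityMeasure P]
    (n : ℕ) [NeZero n] (X : Fin n → Ω → ℝ) (F₀ : ℝ → ℝ)
    (hX : ∀ i, Measurable (X i))
    (hindep : iIndepFun X P)
    (hF₀ : Continuous F₀)
    (hcdf : ∀ i t, P.real {ω | X i ω ≤ t} = F₀ t) :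
    -- the exact distribution function
    (∀ x : ℝ, 0 < x →
      P.real {ω | WStar F₀ (fun i => X i ω) ≤ x}
        = 1 - ∑ k ∈ Finset.Icc 1 n, qFormula n (sRoot ((k : ℝ) / n) x) k) ∧
    (∀ x : ℝ, x ≤ 0 → P.real {ω | WStar F₀ (fun i => X i ω) ≤ x} = 0) ∧
    -- `s(c,x)` lies in `(0,c)` and is a root of `(c - s)² = x² s (1 - s)`
    (∀ c x : ℝ, 0 < c → c ≤ 1 → 0 < x →
      0 < sRoot c x ∧ sRoot c x < c ∧
        (c - sRoot c x) ^ 2 = x ^ 2 * (sRoot c x * (1 - sRoot c x))) ∧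
    -- `q_n[z,k]` is the joint law of `F₀(X_{R:n})` and `R`
    (∀ z : ℝ, 0 ≤ z → z < 1 → ∀ k ∈ Finset.Icc 1 n,
      P.real {ω | U_R F₀ (fun i => X i ω) ≤ z ∧ argmaxRank F₀ (fun i => X i ω) = k}
        = qFormula n z k) := by
  have hnn : 0 < n := Nat.pos_of_ne_zero (NeZero.ne n)
  have hn : (0 : ℝ) < n := by exact_mod_cast hnn
  have i₀ : Fin n := ⟨0, hnn⟩
  have hF : Monotone F₀ := fun a b hab => by
    rw [← hcdf i₀, ← hcdf i₀]
    exact measureReal_mono fun ω hω => le_trans hω hab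
  have h0 : ∀ t, 0 ≤ F₀ t := fun t => by
    rw [← hcdf i₀]
    exact measureReal_nonneg
  have h1 : ∀ t, F₀ t ≤ 1 := fun t => by
    rw [← hcdf i₀]
    exact measureReal_le_one
  have hU : ∀ i, Measurable fun ω => F₀ (X i ω) := fun i => hF₀.measurable.comp (hX i)
  have hindepU : iIndepFun (fun i ω => F₀ (X i ω)) P :=
    hindep.comp (fun _ => F₀) fun _ => hF₀.measurable
  have hlaw : ∀ i, P.map (fun ω => F₀ (X i ω)) = volume.restrict (Set.Ioo 0 1) :=
    fun i => map_cdf_comp_eq_uniform (hX i) hF₀ (hcdf i)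
  have hjoint := fun {z : ℝ} (hz : 0 ≤ z) (hz1 : z < 1) (k : Fin n) =>
    measure_U_R_le_and_argmaxRank_eq (X := X) hF hU hindepU hlaw hz hz1 k
  refine ⟨fun x hx => ?_, fun x hx => ?_, fun c x hc hc1 hx => sRoot_spec hc hc1 hx,
    fun z hz hz1 k hk => ?_⟩
  · set s : Fin n → ℝ := fun k => sRoot ((k + 1 : ℕ) / (n : ℝ)) x with hs
    have hspec : ∀ k : Fin n, 0 ≤ s k ∧ s k < 1 := by
      intro k
      have hc1 : ((k + 1 : ℕ) : ℝ) / n ≤ 1 := by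
        rw [div_le_one hn, Nat.cast_le]
        exact k.2
      obtain ⟨h2, h3, -⟩ := sRoot_spec (by positivity) hc1 hx
      exact ⟨h2.le, h3.trans_le hc1⟩
    set S : Fin n → Set Ω := fun k =>
      {ω | U_R F₀ (fun i => X i ω) ≤ s k ∧ argmaxRank F₀ (fun i => X i ω) = k + 1} with hS
    have hSm : ∀ k, NullMeasurableSet (S k) P := fun k => (hjoint (hspec k).1 (hspec k).2 k).1
    have hae : {ω | WStar F₀ (fun i => X i ω) ≤ x} =ᵐ[P] ((⋃ k, S k)ᶜ : Set Ω) := by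
      rw [Filter.eventuallyEq_set]
      have hne : ∀ᵐ ω ∂P, ∀ i k, F₀ (X i ω) ≠ s k := by
        simp only [ae_all_iff]
        exact fun i k => ae_ne_const (hU i) (hlaw i) (s k)
      filter_upwards [ae_mem_Ioo hU hlaw, hne] with ω hI hneω
      have hUR : 0 < U_R F₀ (fun i => X i ω) ∧ U_R F₀ (fun i => X i ω) < 1 := hI _
      rw [Set.mem_compl_iff, ← not_lt, not_iff_not,
        lt_WStar_iff hF h0 h1 hUR hx, Set.mem_iUnion]
      constructor
      · intro h
        exact ⟨argmaxIndex F₀ fun i => X i ω, h.le, rfl⟩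
      · rintro ⟨k, h2, h3⟩
        rw [h3]
        exact lt_of_le_of_ne h2 (hneω _ k)
    have hdisj : Pairwise (Function.onFun (AEDisjoint P) S) := by
      intro k l hkl
      refine Disjoint.aedisjoint (Set.disjoint_left.2 fun ω h2 h3 => hkl ?_)
      exact Fin.ext (Nat.add_right_cancel (h2.2.symm.trans h3.2))
    have hsum : P.real (⋃ k, S k) = ∑ k, P.real (S k) := by
      rw [measureReal_def, measure_iUnion₀ hdisj hSm, tsum_fintype,
        ENNReal.toReal_sum fun k _ => measure_ne_top _ _]
      rfl
    rw [measureReal_congr hae, measureReal_def, prob_compl_eq_one_sub₀ (.iUnion hSm),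
      ENNReal.toReal_sub_of_le prob_le_one ENNReal.one_ne_top, ENNReal.toReal_one,
      ← measureReal_def, hsum]
    congr 1
    rw [show Finset.Icc 1 n = Finset.Ico 1 (n + 1) by rfl, Finset.sum_Ico_eq_sum_range,
      Nat.add_sub_cancel, ← Fin.sum_univ_eq_sum_range
        (fun k => qFormula n (sRoot (((1 + k : ℕ) : ℝ) / n) x) (1 + k))]
    refine Finset.sum_congr rfl fun k _ => ?_
    rw [(hjoint (hspec k).1 (hspec k).2 k).2, add_comm 1 (k : ℕ)]
  · have : {ω | WStar F₀ (fun i => X i ω) ≤ x} =ᵐ[P] (∅ : Set Ω) := by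
      rw [Filter.eventuallyEq_set]
      filter_upwards [ae_mem_Ioo hU hlaw] with ω hI
      have := WStar_pos hF h0 h1 hI
      simp
      linarith
    rw [measureReal_congr this]
    simp
  · obtain ⟨hk1, hk2⟩ := Finset.mem_Icc.1 hk
    obtain ⟨k, rfl⟩ := Nat.exists_eq_add_of_le' hk1
    exact (hjoint hz hz1 ⟨k, hk2⟩).2
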